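/- Let $\kappa_0,\kappa_1,\kappa_t,\kappa\in\mathbb C$ and $c\in\mathbb C\setminus\{0,1\}$. Put $E(t,\lambda)=\lambda(\lambda-1)(\lambda-t)$ and $F(t,\lambda)=\kappa_0(\lambda-1)(\lambda-t)+\kappa_1\lambda(\lambda-t)+(\kappa_t+1)\lambda(\lambda-1)$, and let $E_\lambda,F_\lambda$ be their derivatives with respect to $\lambda$. The sixth Painlevé system is the Hamiltonian system with $H=\frac{1}{t(t-1)}\left[E(t,\lambda)\nu^2+F(t,\lambda)\nu+\kappa(\lambda-t)\right]$, where $\nu$ is the momentum conjugate to $\lambda$. In the coordinates $(\lambda,\mu,t)$, $\mu=1/\nu$, $t\ne 0,1$, near $\mu=0$, it defines the singular holomorphic foliation (the Painlevé VI foliation) $$d\mu=\frac{\left[E_\lambda(t,\lambda)+F_\lambda(t,\lambda)\mu+\kappa\mu^2\right]\mu}{2E(t,\lambda)+F(t,\lambda)\mu}\,d\lambda,\qquad dt=\frac{t(t-1)\mu}{2E(t,\lambda)+F(t,\lambda)\mu}\,d\lambda ,$$ which has the leaf $D_0(c)=\{\mu=0,\ t=c,\ \lambda\in\mathbb P^1\setminus\{0,1,c,\infty\}\}$.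 Let $P\in\mathbb C\setminus\{0,1,c\}$. The holonomy along a loop in $D_0(c)$ based at $P$ is the germ of holomorphic maps of the cross-section $\{\lambda=P\}$ at $(\mu,t)=(0,c)$ obtained by lifting the loop to the leaves with respect to $(\lambda,\mu,t)\mapsto\lambda$. Let $\gamma_0,\gamma_1,\gamma_c$ be loops in $D_0(c)$ based at $P$ such that $\gamma_a$ makes one turn around $a$ in either direction, i.e. is freely homotopic in $D_0(c)$ to a circle around $a$ which encloses no other puncture. Then: 1. The holonomy germs $h_0,h_1,h_c$ along $\gamma_0,\gamma_1,\gamma_c$ exist and $h_0^2=h_1^2=h_c^2=\mathrm{id}$. If the product loop, $\gamma_c$ followed by $\gamma_1$ followed by $\gamma_0$ (whose holonomy is $h_0h_1h_c$), makes one turn around $\infty$, i.e. is freely homotopic in $D_0(c)$ to a circle enclosing $0,1,c$, then also $(h_0h_1h_c)^2=\mathrm{id}$. All identities are between germs at $(\mu,t)=(0,c)$. 2. Near the singular point $(\lambda,\mu,t)=(0,0,c)$ the leaves sufficiently close to $D_0(c)$ are holomorphic curves which are two-sheeted ramified covers: there are $r,\delta>0$ such that every point $(\lambda,\mu,t)$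 with $\mu\ne0$, $|\lambda+\kappa_0\mu|<r^2$, $|\mu|^2<\delta|\lambda+\kappa_0\mu|$ and $|t-c|<\delta$ lies on an injectively parameterized holomorphic curve $w\mapsto(L(w),M(w),T(w))$, $|w|<r$, with $T\neq 0,1$, which is contained in a leaf for $w\ne0$, with $M(w)\neq 0$ there, passes through $(0,0,T(0))$ at $w=0$ with $M'(0)\ne0$, and satisfies $L(w)+\kappa_0M(w)=w^2$. -/

import Mathlib

open Filter Topology
open scoped unitInterval

namespace PVI

/-- The parameters of the sixth Painlevé system (`kt` is `κ_t`, and `k` is the constant `κ`,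
the coefficient of `λ - t` in the Hamiltonian
`t (t - 1) H = E ν² + F ν + κ (λ - t)`, where `ν` is the momentum conjugate to `λ`). -/
structure Params where
  /-- `κ₀` -/
  k0 : ℂ
  /-- `κ₁` -/
  k1 : ℂ
  /-- `κ_t` -/
  kt : ℂ
  /-- `κ` -/
  k : ℂ

/-- `E(t, x) = x (x - 1) (x - t)`. -/
def E (t x : ℂ) : ℂ := x * (x - 1) * (x - t)

/-- `∂E/∂x`. -/
def Ex (t x : ℂ) : ℂ := (x - 1) * (x - t) + x * (x - t) + x * (x - 1)

/-- `F(t, x) = κ₀ (x - 1) (x - t) + κ₁ x (x - t) + (κ_t + 1) x (x - 1)`. -/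
def F (p : Params) (t x : ℂ) : ℂ :=
  p.k0 * ((x - 1) * (x - t)) + p.k1 * (x * (x - t)) + (p.kt + 1) * (x * (x - 1))

/-- `∂F/∂x`. -/
def Fx (p : Params) (t x : ℂ) : ℂ :=
  p.k0 * ((x - 1) + (x - t)) + p.k1 * (x + (x - t)) + (p.kt + 1) * (x + (x - 1))

/-- First component (along `x`) of the holomorphic vector field in the coordinates `(x, m, t)`,
where `x = λ` and `m = 1 / ν`, whose orbits are the leaves of the Painlevé VI foliation.
It is the Hamiltonian vector field in extended phase space multiplied by `t (t - 1) m`. -/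
def fieldX (p : Params) (x m t : ℂ) : ℂ := 2 * E t x + F p t x * m

/-- Second component (along `m`) of the vector field. -/
def fieldM (p : Params) (x m t : ℂ) : ℂ := (Ex t x + Fx p t x * m + p.k * m ^ 2) * m

/-- Third component (along `t`) of the vector field. -/
def fieldT (m t : ℂ) : ℂ := t * (t - 1) * m

/-- The points of the projective line `{m = 0, t = c}` at finite distance which have to be removed
in order to get the leaf `D₀(c)`. -/
def punctures (c : ℂ) : Set ℂ := {0, 1, c}

/-- Near `z`, the graph `x ↦ (x, φ x, ψ x)` is a piece of a leaf which lies over `t ≠ 0, 1` and is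
transverse to the planes `x = const`; that is, `m = φ x`, `t = ψ x` solve
`dm/dx = fieldM / fieldX`, `dt/dx = fieldT / fieldX`. -/
def IsLocalSolution (p : Params) (φ ψ : ℂ → ℂ) (z : ℂ) : Prop :=
  ∀ᶠ x in 𝓝 z, ψ x ≠ 0 ∧ ψ x ≠ 1 ∧ fieldX p x (φ x) (ψ x) ≠ 0 ∧
    HasDerivAt φ (fieldM p x (φ x) (ψ x) / fieldX p x (φ x) (ψ x)) x ∧
    HasDerivAt ψ (fieldT (φ x) (ψ x) / fieldX p x (φ x) (ψ x)) x

/-- `s ↦ (γ s, Γ s)` is a lift of the path `γ` to a leaf with respect to `(x, m, t) ↦ x`: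
locally it runs on the graph of a local solution. -/
def IsLift (p : Params) (γ : C(I, ℂ)) (Γ : I → ℂ × ℂ) : Prop :=
  ∀ s : I, ∃ φ ψ : ℂ → ℂ, IsLocalSolution p φ ψ (γ s) ∧
    ∀ᶠ u in 𝓝 s, Γ u = (φ (γ u), ψ (γ u))

/-- `h` represents the holonomy germ along the loop `γ` in the leaf `D₀(c) = {m = 0, t = c}`,
on the cross-section `x = γ 0 = γ 1` with coordinates `(m, t)`, centred at `(0, c)`: it is
holomorphic at the centre, and it maps the initial point of a lift of `γ` to its end point. -/
structure IsHolonomyGerm (p : Params) (c : ℂ) (γ : C(I, ℂ)) (h : ℂ × ℂ → ℂ × ℂ) : Prop where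
  analyticAt : AnalyticAt ℂ h (0, c)
  map_center : h (0, c) = (0, c)
  exists_lift : ∀ᶠ y in 𝓝 ((0, c) : ℂ × ℂ),
    ∃ Γ : I → ℂ × ℂ, IsLift p γ Γ ∧ Γ 0 = y ∧ Γ 1 = h y

/-- Free homotopy of closed loops in `D₀(c)`, the projective line without `0, 1, c, ∞`. -/
def FreelyHomotopic (c : ℂ) (γ γ' : C(I, ℂ)) : Prop :=
  ContinuousMap.HomotopicWith γ γ' fun l => l 0 = l 1 ∧ ∀ s, l s ∉ punctures c

/-- The circle with centre `a` and radius `r`, run through `n` times counter-clockwise. -/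
noncomputable def circleLoop (a : ℂ) (r : ℝ) (n : ℤ) : C(I, ℂ) where
  toFun s := a + r * Complex.exp (n * (2 * Real.pi * Complex.I) * ((s : ℝ) : ℂ))

/-- The loop `γ` in `D₀(c)` makes one turn, in either direction, around the puncture `a`: it is
freely homotopic to a circle around `a` which encloses no other puncture. -/
def TurnsOnceAround (c a : ℂ) (γ : C(I, ℂ)) : Prop :=
  ∃ r : ℝ, 0 < r ∧ (∀ b ∈ punctures c, b ≠ a → r < dist b a) ∧
    (FreelyHomotopic c γ (circleLoop a r 1) ∨ FreelyHomotopic c γ (circleLoop a r (-1)))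

/-- The loop `γ` in `D₀(c)` makes one turn, in either direction, around the puncture `∞`: it is
freely homotopic to a circle which encloses the punctures `0, 1, c`. -/
def TurnsOnceAroundInfinity (c : ℂ) (γ : C(I, ℂ)) : Prop :=
  ∃ R : ℝ, 0 < R ∧ (∀ b ∈ punctures c, ‖b‖ < R) ∧
    (FreelyHomotopic c γ (circleLoop 0 R 1) ∨ FreelyHomotopic c γ (circleLoop 0 R (-1)))

/-- `w ↦ (L w, M w, T w)`, on the disc `‖w‖ < r`, is an injective holomorphic curve, regular at
`w = 0`, where it passes through the singular point `(0, 0, T 0)`; it lies in a leaf for `w ≠ 0`,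
and `x + κ₀ m` makes it a two-sheeted cover of a disc, ramified at `w = 0`. -/
structure IsTwoSheetedLeaf (p : Params) (r : ℝ) (L M T : ℂ → ℂ) : Prop where
  holL : DifferentiableOn ℂ L (Metric.ball 0 r)
  holM : DifferentiableOn ℂ M (Metric.ball 0 r)
  holT : DifferentiableOn ℂ T (Metric.ball 0 r)
  injOn : Set.InjOn (fun w => (L w, M w, T w)) (Metric.ball 0 r)
  ramified : ∀ w ∈ Metric.ball (0 : ℂ) r, L w + p.k0 * M w = w ^ 2
  centerL : L 0 = 0
  centerM : M 0 = 0
  regular : deriv M 0 ≠ 0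
  base : ∀ w ∈ Metric.ball (0 : ℂ) r, T w ≠ 0 ∧ T w ≠ 1
  off_zero : ∀ w ∈ Metric.ball (0 : ℂ) r, w ≠ 0 → M w ≠ 0
  tangent : ∀ w ∈ Metric.ball (0 : ℂ) r, w ≠ 0 → ∃ s : ℂ,
    HasDerivAt L (s * fieldX p (L w) (M w) (T w)) w ∧
    HasDerivAt M (s * fieldM p (L w) (M w) (T w)) w ∧
    HasDerivAt T (s * fieldT (M w) (T w)) w

end PVI

/-! The singularities of the foliation along `m = 0` disappear after a twofold ramified
substitution. Near a fixed puncture `a` put `x - a + α m = w ^ 2`, `m = w y`; near the moving one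
put `x - t + κ_t m = w ^ 2`, `m = w y`. In `(w, y, t)` the leaves solve `y' = y n₁ / A`, `t' = y n₂
/ A` with polynomials for which `A ≠ 0` at `(0, 0, c)`. The disc `y = 0`, `t = c` is then a regular
solution, and it covers a neighbourhood of the puncture in `m = 0` twice. A disc carries no
monodromy, so a circle around the puncture, run through twice, has closed lifts; hence the square of
its holonomy is the identity (`eventually_exists_closed_lift`, `isInvolutive_circleLoop`). At
infinity the same works with `x = 1 / z` and `m` twisted by a root `ρ` of a quadratic equation
(`mapsTangent_infty`).

The analytic tool is a flow along segments in the complex plane. Solutions near `(y, t) = (0, c)`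
are zeros of an integral equation in the Banach algebra `C(I, ℂ)`. Its linearization at the constant
solution is triangular, with diagonal blocks `1` and `1` minus a Volterra operator, hence
invertible; the analytic inverse function theorem makes the flow holomorphic jointly in both end
points and the initial value (`exists_local_flow`, `eventually_goodFlow`).

Pushing lifts from a path to a nearby path by this flow carries holonomy along
(`HasHolonomy.transport`). Chaining such moves along a homotopy gives existence of holonomy
(contract the path to a point) and, for closed loops, conjugation of holonomies under free homotopy;
being an involution is therefore a free homotopy invariant and has to be checked on circles only.

The two-sheeted leaves come from the chart at `0`: on a small disc `y` is nearly constant and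
nonzero, so `m = w y` separates the points `w` and `-w` (`exists_isTwoSheetedLeaf`). -/

namespace PVI

open Set MeasureTheory
open scoped NNReal

/-! ### Volterra operators on `C(I, ℂ)` -/

/-- The antiderivative, vanishing at `0`, of a continuous function on the unit interval. -/
noncomputable def antideriv (f : C(I, ℂ)) (s : ℝ) : ℂ :=
  ∫ u in (0 : ℝ)..s, f (projIcc 0 1 zero_le_one u)

lemma continuous_extend (f : C(I, ℂ)) : Continuous fun u : ℝ => f (projIcc 0 1 zero_le_one u) :=
  f.continuous.comp continuous_projIcc

lemma hasDerivAt_antideriv (f : C(I, ℂ)) (s : ℝ) :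
    HasDerivAt (antideriv f) (f (projIcc 0 1 zero_le_one s)) s :=
  intervalIntegral.integral_hasDerivAt_right ((continuous_extend f).intervalIntegrable _ _)
    ((continuous_extend f).stronglyMeasurableAtFilter _ _) (continuous_extend f).continuousAt

lemma continuous_antideriv (f : C(I, ℂ)) : Continuous (antideriv f) :=
  continuous_iff_continuousAt.2 fun s => (hasDerivAt_antideriv f s).continuousAt

lemma norm_antideriv_le (f : C(I, ℂ)) {g : ℝ → ℝ} (hg : Continuous g)
    (h : ∀ s : I, ‖f s‖ ≤ g s) (s : I) : ‖antideriv f s‖ ≤ ∫ u in (0 : ℝ)..s, g u := by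
  refine intervalIntegral.norm_integral_le_of_norm_le s.2.1 ?_ (hg.intervalIntegrable _ _)
  filter_upwards with u hu
  have hu' : u ∈ Icc (0 : ℝ) 1 := ⟨hu.1.le, hu.2.trans s.2.2⟩
  rw [projIcc_of_mem _ hu']
  exact h ⟨u, hu'⟩

/-- The antiderivative as a continuous linear endomorphism of `C(I, ℂ)`. -/
noncomputable def antiderivL : C(I, ℂ) →L[ℂ] C(I, ℂ) :=
  LinearMap.mkContinuous
    { toFun := fun f => ⟨fun s => antideriv f s, (continuous_antideriv f).comp continuous_subtype_val⟩
      map_add' := fun f g => by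
        ext s
        simp only [antideriv, ContinuousMap.coe_mk, ContinuousMap.add_apply]
        exact intervalIntegral.integral_add ((continuous_extend f).intervalIntegrable _ _)
          ((continuous_extend g).intervalIntegrable _ _)
      map_smul' := fun a f => by
        ext s
        simp [antideriv] } 1 (by
      intro f
      rw [one_mul, ContinuousMap.norm_le _ (norm_nonneg _)]
      intro s
      refine (norm_antideriv_le f continuous_const (fun s => f.norm_coe_le_norm s) s).trans ?_
      simp only [intervalIntegral.integral_const, sub_zero, smul_eq_mul]
      exact mul_le_of_le_one_left (norm_nonneg _) s.2.2)

@[simp] lemma antiderivL_apply (f : C(I, ℂ)) (s : I) : antiderivL f s = antideriv f s := rfl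

/-- The Volterra operator `z ↦ l ∫₀ a z`. -/
noncomputable def volterra (l : ℂ) (a : C(I, ℂ)) : C(I, ℂ) →L[ℂ] C(I, ℂ) :=
  l • antiderivL.comp (ContinuousLinearMap.mul ℂ C(I, ℂ) a)

lemma volterra_apply (l : ℂ) (a f : C(I, ℂ)) : volterra l a f = l • antiderivL (a * f) := rfl

/-- The power of `s` must be kept in the induction: integrating `s ^ n` produces the factor `1 / (n
+ 1)`, and these build up the factorial. -/
lemma norm_volterra_pow_le (l : ℂ) (a f : C(I, ℂ)) (n : ℕ) (s : I) :
    ‖(volterra l a ^ n) f s‖ ≤ (‖l‖ * ‖a‖) ^ n * (s : ℝ) ^ n / n.factorial * ‖f‖ := by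
  induction n generalizing s with
  | zero => simpa using f.norm_coe_le_norm s
  | succ n ih =>
    rw [pow_succ', mul_apply_eq_comp, volterra_apply]
    have h1 : ∀ s : I, ‖(a * (volterra l a ^ n) f) s‖ ≤
        ‖a‖ * ((‖l‖ * ‖a‖) ^ n / n.factorial * ‖f‖) * (s : ℝ) ^ n := by
      intro s
      rw [ContinuousMap.mul_apply, norm_mul]
      calc _ ≤ ‖a‖ * ((‖l‖ * ‖a‖) ^ n * (s : ℝ) ^ n / n.factorial * ‖f‖) :=
            mul_le_mul (a.norm_coe_le_norm s) (ih s) (norm_nonneg _) (norm_nonneg _)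
        _ = _ := by ring
    have h2 := norm_antideriv_le (a * (volterra l a ^ n) f)
      (g := fun s => ‖a‖ * ((‖l‖ * ‖a‖) ^ n / n.factorial * ‖f‖) * s ^ n) (by fun_prop) h1 s
    rw [intervalIntegral.integral_const_mul, integral_pow] at h2
    rw [ContinuousMap.smul_apply, norm_smul, antiderivL_apply]
    refine (mul_le_mul_of_nonneg_left h2 (norm_nonneg l)).trans (le_of_eq ?_)
    rw [Nat.factorial_succ]
    push_cast
    have := Nat.cast_ne_zero (R := ℝ).2 n.factorial_ne_zero
    field_simp
    ring

/-- The factorial makes some power of the operator a strict contraction, whatever the size of `l`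
and `a`. So `1 - V ^ n` is a unit, and `1 - V` is a factor of it commuting with the geometric sum.
-/
lemma isUnit_one_sub_volterra (l : ℂ) (a : C(I, ℂ)) : IsUnit (1 - volterra l a) := by
  obtain ⟨n, hn⟩ := ((FloorSemiring.tendsto_pow_div_factorial_atTop (‖l‖ * ‖a‖)).eventually
    (gt_mem_nhds one_pos)).exists
  have hlt : ‖volterra l a ^ n‖ < 1 := by
    refine lt_of_le_of_lt (ContinuousLinearMap.opNorm_le_bound _ (by positivity) fun f => ?_) hn
    rw [ContinuousMap.norm_le _ (by positivity)]
    intro s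
    refine (norm_volterra_pow_le l a f n s).trans ?_
    have : (s : ℝ) ^ n ≤ 1 := pow_le_one₀ s.2.1 s.2.2
    gcongr
    exact mul_le_of_le_one_right (by positivity) this
  have h1 : IsUnit (1 - volterra l a ^ n) := isUnit_one_sub_of_norm_lt_one (R := C(I, ℂ) →L[ℂ] C(I, ℂ)) hlt
  have h2 : (1 - volterra l a) * ∑ i ∈ Finset.range n, volterra l a ^ i = 1 - volterra l a ^ n :=
    mul_neg_geom_sum (volterra l a) n
  rw [← h2] at h1
  refine ((Commute.isUnit_mul_iff ?_).1 h1).1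
  exact (commute_iff_eq _ _).2 (h2.trans (geom_sum_mul_neg (volterra l a) n).symm)

/-! ### The integral equation and its holomorphic solution -/

/-- Polynomial data of the system `y' = y n₁ / A`, `t' = y n₂ / A` in the variables `(w, y, t)`. -/
structure Sys where
  /-- numerator of `y' / y` -/
  n1 : MvPolynomial (Fin 3) ℂ
  /-- numerator of `t' / y` -/
  n2 : MvPolynomial (Fin 3) ℂ
  /-- common denominator -/
  A : MvPolynomial (Fin 3) ℂ

/-- Value of a polynomial at `(w, y, t)`, where `z = (y, t)`. -/
noncomputable def evalAt (q : MvPolynomial (Fin 3) ℂ) (w : ℂ) (z : ℂ × ℂ) : ℂ :=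
  MvPolynomial.eval ![w, z.1, z.2] q

/-- The right-hand side of the system. -/
noncomputable def Sys.rhs (S : Sys) (w : ℂ) (z : ℂ × ℂ) : ℂ × ℂ :=
  (z.1 * (evalAt S.n1 w z * (evalAt S.A w z)⁻¹), z.1 * (evalAt S.n2 w z * (evalAt S.A w z)⁻¹))

/-- The affine path from `p.1` to `p.2`. -/
noncomputable def linePath (p : ℂ × ℂ) : C(I, ℂ) :=
  p.1 • (1 : C(I, ℂ)) + (p.2 - p.1) • ⟨fun s : I => ((s : ℝ) : ℂ), by fun_prop⟩

/-- Superposition of a polynomial with a path in `(y, t)`-space over an affine path. -/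
noncomputable def superpos (q : MvPolynomial (Fin 3) ℂ) (x : (ℂ × ℂ) × C(I, ℂ) × C(I, ℂ)) :
    C(I, ℂ) :=
  MvPolynomial.aeval ![linePath x.1, x.2.1, x.2.2] q

lemma superpos_apply (q : MvPolynomial (Fin 3) ℂ) (x : (ℂ × ℂ) × C(I, ℂ) × C(I, ℂ)) (s : I) :
    superpos q x s = evalAt q (x.1.1 + s * (x.1.2 - x.1.1)) (x.2.1 s, x.2.2 s) := by
  unfold superpos evalAt
  induction q using MvPolynomial.induction_on with
  | C a => simp
  | add p q hp hq => simp [hp, hq]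
  | mul_X p i hp =>
    simp only [map_mul, ContinuousMap.mul_apply, hp, MvPolynomial.aeval_X, MvPolynomial.eval_X]
    congr 1
    fin_cases i <;> simp [linePath, mul_comm]

/-- The difference of the end points of the affine path, as a linear map. -/
noncomputable def incrL : (ℂ × ℂ) × C(I, ℂ) × C(I, ℂ) →L[ℂ] ℂ :=
  ((ContinuousLinearMap.snd ℂ ℂ ℂ) - (ContinuousLinearMap.fst ℂ ℂ ℂ)).comp
    (ContinuousLinearMap.fst ℂ (ℂ × ℂ) (C(I, ℂ) × C(I, ℂ)))

/-- The first component of the path, as a linear map. -/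
noncomputable def pathL : (ℂ × ℂ) × C(I, ℂ) × C(I, ℂ) →L[ℂ] C(I, ℂ) :=
  (ContinuousLinearMap.fst ℂ C(I, ℂ) C(I, ℂ)).comp
    (ContinuousLinearMap.snd ℂ (ℂ × ℂ) (C(I, ℂ) × C(I, ℂ)))

@[simp] lemma incrL_apply (x : (ℂ × ℂ) × C(I, ℂ) × C(I, ℂ)) : incrL x = x.1.2 - x.1.1 := rfl

@[simp] lemma pathL_apply (x : (ℂ × ℂ) × C(I, ℂ) × C(I, ℂ)) : pathL x = x.2.1 := rfl

lemma analyticAt_superpos (q : MvPolynomial (Fin 3) ℂ) (x : (ℂ × ℂ) × C(I, ℂ) × C(I, ℂ)) :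
    AnalyticAt ℂ (superpos q) x := by
  refine AnalyticAt.aeval_mvPolynomial (fun i => ?_) q
  fin_cases i
  · exact ((analyticAt_fst.comp analyticAt_fst).smul analyticAt_const).add
      ((incrL.analyticAt x).smul analyticAt_const)
  · exact pathL.analyticAt x
  · exact analyticAt_snd.comp analyticAt_snd

/-- Superposition of the quotient `q / A`. -/
noncomputable def superquot (S : Sys) (q : MvPolynomial (Fin 3) ℂ)
    (x : (ℂ × ℂ) × C(I, ℂ) × C(I, ℂ)) : C(I, ℂ) :=
  superpos q x * Ring.inverse (superpos S.A x)

lemma analyticAt_superquot (S : Sys) (q : MvPolynomial (Fin 3) ℂ)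
    {x : (ℂ × ℂ) × C(I, ℂ) × C(I, ℂ)} (h : IsUnit (superpos S.A x)) :
    AnalyticAt ℂ (superquot S q) x := by
  obtain ⟨u, hu⟩ := h
  have : AnalyticAt ℂ Ring.inverse (superpos S.A x) := hu ▸ analyticAt_inverse u
  exact (analyticAt_superpos q x).mul (this.comp (analyticAt_superpos S.A x))

lemma superquot_apply (S : Sys) (q : MvPolynomial (Fin 3) ℂ)
    {x : (ℂ × ℂ) × C(I, ℂ) × C(I, ℂ)} (h : IsUnit (superpos S.A x)) (s : I) :
    superquot S q x s = superpos q x s * (superpos S.A x s)⁻¹ := by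
  have h1 := congrArg (fun f : C(I, ℂ) => f s) (Ring.mul_inverse_cancel _ h)
  simp only [ContinuousMap.mul_apply, ContinuousMap.one_apply] at h1
  rw [superquot, ContinuousMap.mul_apply, eq_inv_of_mul_eq_one_right h1]

/-- The term `∫ y q / A dw` of the integral equation. -/
noncomputable def integralTerm (S : Sys) (q : MvPolynomial (Fin 3) ℂ)
    (x : (ℂ × ℂ) × C(I, ℂ) × C(I, ℂ)) : C(I, ℂ) :=
  (x.1.2 - x.1.1) • antiderivL (x.2.1 * superquot S q x)

lemma analyticAt_integralTerm (S : Sys) (q : MvPolynomial (Fin 3) ℂ)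
    {x : (ℂ × ℂ) × C(I, ℂ) × C(I, ℂ)} (h : IsUnit (superpos S.A x)) :
    AnalyticAt ℂ (integralTerm S q) x := by
  have h1 := analyticAt_superquot S q h
  have h2 : AnalyticAt ℂ (fun x : (ℂ × ℂ) × C(I, ℂ) × C(I, ℂ) => x.2.1 * superquot S q x) x :=
    (pathL.analyticAt x).mul h1
  have h3 := (antiderivL.analyticAt _).comp h2
  exact (incrL.analyticAt x).smul h3

/-- Because the integrand carries the factor `y`, which vanishes at the base point, the product rule
leaves only the variation of `y`; variations of the end points, of `t` and of `q / A` contribute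
nothing. -/
lemma hasStrictFDerivAt_integralTerm (S : Sys) (q : MvPolynomial (Fin 3) ℂ)
    {x : (ℂ × ℂ) × C(I, ℂ) × C(I, ℂ)} (h : IsUnit (superpos S.A x)) (h0 : x.2.1 = 0) :
    HasStrictFDerivAt (integralTerm S q)
      ((volterra (x.1.2 - x.1.1) (superquot S q x)).comp pathL) x := by
  have h1 := (analyticAt_superquot S q h).hasStrictFDerivAt
  have h3 := antiderivL.hasStrictFDerivAt.comp x ((pathL.hasStrictFDerivAt (x := x)).mul h1)
  refine ((incrL.hasStrictFDerivAt (x := x)).smul h3).congr_fderiv ?_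
  refine ContinuousLinearMap.ext fun v => ?_
  have hp : pathL x = 0 := h0
  change incrL x • antiderivL (pathL x * fderiv ℂ (superquot S q) x v +
    superquot S q x * pathL v) + incrL v • antiderivL (pathL x * superquot S q x) =
      incrL x • antiderivL (superquot S q x * pathL v)
  rw [hp, zero_mul, zero_mul, map_zero, zero_add]
  ext s
  simp

/-- The map whose zeros (in the last two components, up to constants) are the solutions of the
integral equation along affine paths. -/
noncomputable def integralMap (S : Sys) (x : (ℂ × ℂ) × C(I, ℂ) × C(I, ℂ)) :
    (ℂ × ℂ) × C(I, ℂ) × C(I, ℂ) :=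
  (x.1, x.2.1 - integralTerm S S.n1 x, x.2.2 - integralTerm S S.n2 x)

/-- The continuous linear equivalence `(p, a, b) ↦ (p, u a, b - V a)`. -/
noncomputable def shearEquiv (u : (C(I, ℂ) →L[ℂ] C(I, ℂ))ˣ) (V : C(I, ℂ) →L[ℂ] C(I, ℂ)) :
    ((ℂ × ℂ) × C(I, ℂ) × C(I, ℂ)) ≃L[ℂ] ((ℂ × ℂ) × C(I, ℂ) × C(I, ℂ)) :=
  ContinuousLinearEquiv.equivOfInverse
    ((ContinuousLinearMap.fst ℂ _ _).prod (((u : C(I, ℂ) →L[ℂ] C(I, ℂ)).comp pathL).prod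
      ((ContinuousLinearMap.snd ℂ _ _).comp (ContinuousLinearMap.snd ℂ _ _) - V.comp pathL)))
    ((ContinuousLinearMap.fst ℂ _ _).prod (((↑u⁻¹ : C(I, ℂ) →L[ℂ] C(I, ℂ)).comp pathL).prod
      ((ContinuousLinearMap.snd ℂ _ _).comp (ContinuousLinearMap.snd ℂ _ _) +
        V.comp ((↑u⁻¹ : C(I, ℂ) →L[ℂ] C(I, ℂ)).comp pathL))))
    (fun x => by
      have h : ∀ f, (↑u⁻¹ : C(I, ℂ) →L[ℂ] C(I, ℂ)) ((u : C(I, ℂ) →L[ℂ] C(I, ℂ)) f) = f :=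
        fun f => by
          rw [← mul_apply_eq_comp, Units.inv_mul]
          rfl
      simp [h])
    (fun x => by
      have h : ∀ f, (u : C(I, ℂ) →L[ℂ] C(I, ℂ)) ((↑u⁻¹ : C(I, ℂ) →L[ℂ] C(I, ℂ)) f) = f :=
        fun f => by
          rw [← mul_apply_eq_comp, Units.mul_inv]
          rfl
      simp [h])

/-- The derivative is block triangular: identity on the end points, `1 - V₁` on `y`, and `b ↦ b - V₂
a` on `t`. Only the block `1 - V₁` needs an argument. -/
lemma exists_hasStrictFDerivAt_integralMap (S : Sys)
    {x : (ℂ × ℂ) × C(I, ℂ) × C(I, ℂ)} (h : IsUnit (superpos S.A x)) (h0 : x.2.1 = 0) :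
    ∃ e : ((ℂ × ℂ) × C(I, ℂ) × C(I, ℂ)) ≃L[ℂ] ((ℂ × ℂ) × C(I, ℂ) × C(I, ℂ)),
      HasStrictFDerivAt (integralMap S)
        (e : ((ℂ × ℂ) × C(I, ℂ) × C(I, ℂ)) →L[ℂ] ((ℂ × ℂ) × C(I, ℂ) × C(I, ℂ))) x := by
  obtain ⟨u, hu⟩ := isUnit_one_sub_volterra (x.1.2 - x.1.1) (superquot S S.n1 x)
  refine ⟨shearEquiv u (volterra (x.1.2 - x.1.1) (superquot S S.n2 x)), ?_⟩
  have h1 := (pathL.hasStrictFDerivAt (x := x)).sub (hasStrictFDerivAt_integralTerm S S.n1 h h0)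
  have h2 := (((ContinuousLinearMap.snd ℂ C(I, ℂ) C(I, ℂ)).comp
    (ContinuousLinearMap.snd ℂ (ℂ × ℂ) _)).hasStrictFDerivAt (x := x)).sub
      (hasStrictFDerivAt_integralTerm S S.n2 h h0)
  have h3 := ((ContinuousLinearMap.fst ℂ (ℂ × ℂ) (C(I, ℂ) × C(I, ℂ))).hasStrictFDerivAt
    (x := x)).prodMk (h1.prodMk h2)
  refine h3.congr_fderiv (ContinuousLinearMap.ext fun v => ?_)
  simp [shearEquiv, hu]

lemma analyticAt_integralMap (S : Sys)
    {x : (ℂ × ℂ) × C(I, ℂ) × C(I, ℂ)} (h : IsUnit (superpos S.A x)) :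
    AnalyticAt ℂ (integralMap S) x :=
  analyticAt_fst.prod (((pathL.analyticAt x).sub (analyticAt_integralTerm S S.n1 h)).prod
    (AnalyticAt.sub (analyticAt_snd.comp analyticAt_snd) (analyticAt_integralTerm S S.n2 h)))

/-- `Z` solves the system along the affine path from `w0` to `w`, and it stays in the closed ball
of radius `η` around the stationary point `(0, c)`. -/
structure IsRay (S : Sys) (c : ℂ) (η : ℝ) (w0 w : ℂ) (Z : ℝ → ℂ × ℂ) : Prop where
  hasDerivAt : ∀ s ∈ Icc (0 : ℝ) 1,
    HasDerivAt Z ((w - w0) • S.rhs (w0 + s * (w - w0)) (Z s)) s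
  mem_closedBall : ∀ s ∈ Icc (0 : ℝ) 1, Z s ∈ Metric.closedBall ((0, c) : ℂ × ℂ) η

lemma isRay_of_integralMap (S : Sys) {c : ℂ} {η : ℝ} {x : (ℂ × ℂ) × C(I, ℂ) × C(I, ℂ)}
    (h : IsUnit (superpos S.A x)) {z : ℂ × ℂ}
    (hx : integralMap S x = (x.1, z.1 • (1 : C(I, ℂ)), z.2 • (1 : C(I, ℂ))))
    (hd : ∀ s : I, (x.2.1 s, x.2.2 s) ∈ Metric.closedBall ((0, c) : ℂ × ℂ) η) :
    ∃ Z, IsRay S c η x.1.1 x.1.2 Z ∧ Z 0 = z ∧ Z 1 = (x.2.1 1, x.2.2 1) := by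
  set l := x.1.2 - x.1.1 with hl
  let Z : ℝ → ℂ × ℂ := fun s => (z.1 + l * antideriv (x.2.1 * superquot S S.n1 x) s,
    z.2 + l * antideriv (x.2.1 * superquot S S.n2 x) s)
  have hZ : ∀ s : I, Z s = (x.2.1 s, x.2.2 s) := by
    intro s
    have h1 := congrArg (fun y : (ℂ × ℂ) × C(I, ℂ) × C(I, ℂ) => (y.2.1 s, y.2.2 s)) hx
    simp only [integralMap, integralTerm, ContinuousMap.sub_apply, ContinuousMap.smul_apply,
      antiderivL_apply, Prod.mk.injEq, smul_eq_mul, ContinuousMap.one_apply, mul_one] at h1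
    ext
    · linear_combination -h1.1
    · linear_combination -h1.2
  refine ⟨Z, ⟨fun s hs => ?_, fun s hs => hZ ⟨s, hs⟩ ▸ hd ⟨s, hs⟩⟩, ?_, hZ 1⟩
  · have h1 := ((hasDerivAt_antideriv (x.2.1 * superquot S S.n1 x) s).const_mul l).const_add z.1
    have h2 := ((hasDerivAt_antideriv (x.2.1 * superquot S S.n2 x) s).const_mul l).const_add z.2
    refine (h1.prodMk h2).congr_deriv ?_
    rw [projIcc_of_mem _ hs, show Z s = _ from hZ ⟨s, hs⟩]
    simp [Sys.rhs, superquot_apply S _ h, superpos_apply, hl]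
  · simp [Z, antideriv]

/-- The analytic inverse function theorem is applied at the constant path `(0, c)`. Since the end
points of the segment are coordinates of the Banach space, the inverse is holomorphic in them as
well as in the initial value; evaluating the path at `1` gives `Φ`. -/
theorem exists_local_flow (S : Sys) (c w0 w : ℂ)
    (hA : ∀ s ∈ Icc (0 : ℝ) 1, evalAt S.A (w0 + s * (w - w0)) (0, c) ≠ 0) {η : ℝ} (hη : 0 < η) :
    ∃ Φ : (ℂ × ℂ) × (ℂ × ℂ) → ℂ × ℂ, AnalyticAt ℂ Φ ((w0, w), (0, c)) ∧
      ∀ᶠ q in 𝓝 (((w0, w), (0, c)) : (ℂ × ℂ) × (ℂ × ℂ)),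
        ∃ Z, IsRay S c η q.1.1 q.1.2 Z ∧ Z 0 = q.2 ∧ Z 1 = Φ q := by
  set x0 : (ℂ × ℂ) × C(I, ℂ) × C(I, ℂ) := ((w0, w), 0, c • 1) with hx0
  have hu : IsUnit (superpos S.A x0) := by
    rw [ContinuousMap.isUnit_iff_forall_ne_zero]
    intro s
    rw [superpos_apply]
    simpa [x0] using hA s s.2
  obtain ⟨e, he⟩ := exists_hasStrictFDerivAt_integralMap S hu rfl
  let g := he.toOpenPartialHomeomorph (integralMap S)
  have hsrc : x0 ∈ g.source := he.mem_toOpenPartialHomeomorph_source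
  have hg0 : integralMap S x0 = x0 := by
    simp only [integralMap, integralTerm, x0, zero_mul, map_zero]
    refine congrArg₂ _ rfl (congrArg₂ _ ?_ ?_) <;>
    · ext s
      simp
  have hsymm : AnalyticAt ℂ g.symm x0 := by
    have := g.analyticAt_symm' hsrc (analyticAt_integralMap S hu) he.hasFDerivAt.fderiv
    rwa [show g x0 = x0 from hg0] at this
  have hgx0 : g.symm x0 = x0 := by
    have := g.left_inv hsrc
    rwa [show g x0 = x0 from hg0] at this
  let ι : (ℂ × ℂ) × (ℂ × ℂ) → (ℂ × ℂ) × C(I, ℂ) × C(I, ℂ) :=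
    fun q => (q.1, q.2.1 • 1, q.2.2 • 1)
  have hι : AnalyticAt ℂ ι ((w0, w), (0, c)) :=
    analyticAt_fst.prod (((analyticAt_fst.comp analyticAt_snd).smul analyticAt_const).prod
      ((analyticAt_snd.comp analyticAt_snd).smul analyticAt_const))
  have hι0 : ι ((w0, w), (0, c)) = x0 :=
    congrArg₂ _ rfl (congrArg₂ _ (zero_smul ℂ (1 : C(I, ℂ))) rfl)
  have hR : AnalyticAt ℂ (fun q => g.symm (ι q)) ((w0, w), (0, c)) :=
    AnalyticAt.comp (by rwa [hι0]) hι
  have hR0 : g.symm (ι ((w0, w), (0, c))) = x0 := by rw [hι0, hgx0]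
  let ev : C(I, ℂ) →L[ℂ] ℂ := ContinuousMap.evalCLM ℂ (1 : I)
  refine ⟨fun q => (ev (g.symm (ι q)).2.1, ev (g.symm (ι q)).2.2), ?_, ?_⟩
  · exact ((ev.analyticAt _).comp ((pathL.analyticAt _).comp hR)).prod
      ((ev.analyticAt _).comp ((analyticAt_snd.comp analyticAt_snd).comp hR))
  · have ht : ∀ᶠ q in 𝓝 (((w0, w), (0, c)) : (ℂ × ℂ) × (ℂ × ℂ)), ι q ∈ g.target := by
      refine hι.continuousAt.eventually (g.open_target.mem_nhds ?_)
      rw [hι0, ← show g x0 = x0 from hg0]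
      exact g.map_source hsrc
    have hun : ∀ᶠ q in 𝓝 (((w0, w), (0, c)) : (ℂ × ℂ) × (ℂ × ℂ)),
        IsUnit (superpos S.A (g.symm (ι q))) := by
      refine hR.continuousAt.eventually
        ((analyticAt_superpos S.A _).continuousAt.eventually (Units.isOpen.mem_nhds ?_))
      beta_reduce
      rw [hR0]
      exact hu
    -- Continuity of the inverse in the sup norm confines the whole path, not just its end point, to
    -- the ball of radius `η`.
    have hcl : ∀ᶠ q in 𝓝 (((w0, w), (0, c)) : (ℂ × ℂ) × (ℂ × ℂ)),
        g.symm (ι q) ∈ Metric.ball x0 η :=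
      hR.continuousAt.eventually (by beta_reduce; rw [hR0]; exact Metric.ball_mem_nhds _ hη)
    filter_upwards [ht, hun, hcl] with q h1 h2 h3
    have h4 : integralMap S (g.symm (ι q)) = ι q := g.right_inv h1
    have h5 : (g.symm (ι q)).1 = q.1 := congrArg Prod.fst h4
    obtain ⟨Z, hZ, hZ0, hZ1⟩ := isRay_of_integralMap S (c := c) (η := η) h2 (z := q.2)
      (by rw [h4, h5]) (by
        intro s
        have h6 : dist (g.symm (ι q)).2.1 x0.2.1 ≤ η :=
          ((le_max_left _ _).trans (le_max_right _ _)).trans (Metric.mem_ball.1 h3).le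
        have h7 : dist (g.symm (ι q)).2.2 x0.2.2 ≤ η :=
          ((le_max_right _ _).trans (le_max_right _ _)).trans (Metric.mem_ball.1 h3).le
        rw [Metric.mem_closedBall, Prod.dist_eq]
        refine max_le ?_ ?_
        · simpa [x0] using ((ContinuousMap.dist_apply_le_dist s).trans h6)
        · simpa [x0] using ((ContinuousMap.dist_apply_le_dist s).trans h7))
    rw [h5] at hZ
    exact ⟨Z, hZ, hZ0, hZ1⟩

/-! ### Regular boxes and segments -/

lemma analyticAt_evalAt (q : MvPolynomial (Fin 3) ℂ) (x : ℂ × ℂ × ℂ) :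
    AnalyticAt ℂ (fun x : ℂ × ℂ × ℂ => evalAt q x.1 x.2) x := by
  refine AnalyticAt.aeval_mvPolynomial (fun i => ?_) q
  fin_cases i
  · exact analyticAt_fst
  · exact analyticAt_fst.comp analyticAt_snd
  · exact analyticAt_snd.comp analyticAt_snd

lemma analyticAt_rhs (S : Sys) {x : ℂ × ℂ × ℂ} (h : evalAt S.A x.1 x.2 ≠ 0) :
    AnalyticAt ℂ (fun x : ℂ × ℂ × ℂ => S.rhs x.1 x.2) x := by
  have h1 : AnalyticAt ℂ (fun x : ℂ × ℂ × ℂ => x.2.1) x := analyticAt_fst.comp analyticAt_snd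
  exact (h1.mul ((analyticAt_evalAt S.n1 x).mul ((analyticAt_evalAt S.A x).inv h))).prod
    (h1.mul ((analyticAt_evalAt S.n2 x).mul ((analyticAt_evalAt S.A x).inv h)))

lemma exists_lipschitz_rhs (S : Sys) {w0 : ℂ} {z0 : ℂ × ℂ} (h : evalAt S.A w0 z0 ≠ 0) :
    ∃ K : ℝ≥0, ∃ r > 0, ∀ w ∈ Metric.ball w0 r,
      LipschitzOnWith K (S.rhs w) (Metric.closedBall z0 r) ∧
        ∀ z ∈ Metric.closedBall z0 r, evalAt S.A w z ≠ 0 := by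
  obtain ⟨K, t, ht, hK⟩ := ((analyticAt_rhs S (x := (w0, z0)) h).contDiffAt
    (n := 1)).exists_lipschitzOnWith
  have h1 : ∀ᶠ x : ℂ × ℂ × ℂ in 𝓝 (w0, z0), evalAt S.A x.1 x.2 ≠ 0 :=
    (analyticAt_evalAt S.A (w0, z0)).continuousAt.eventually_ne h
  obtain ⟨r, hr, hr'⟩ := Metric.nhds_basis_closedBall.mem_iff.1 (inter_mem ht h1)
  have hmem : ∀ w ∈ Metric.ball w0 r, ∀ z ∈ Metric.closedBall z0 r,
      ((w, z) : ℂ × ℂ × ℂ) ∈ Metric.closedBall ((w0, z0) : ℂ × ℂ × ℂ) r := fun w hw z hz =>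
    max_le (Metric.mem_ball.1 hw).le hz
  refine ⟨K, r, hr, fun w hw => ⟨?_, fun z hz => (hr' (hmem w hw z hz)).2⟩⟩
  intro x hx y hy
  refine (hK (hr' (hmem w hw x hx)).1 (hr' (hmem w hw y hy)).1).trans (le_of_eq ?_)
  simp [Prod.edist_eq]

/-- On `V` times the closed ball of radius `η` around `(0, c)` the system is regular, and
uniformly Lipschitz. -/
structure Box (S : Sys) (c : ℂ) (V : Set ℂ) (η : ℝ) (K : ℝ≥0) : Prop where
  isOpen : IsOpen V
  pos : 0 < η
  ne_zero : ∀ w ∈ V, ∀ z ∈ Metric.closedBall ((0, c) : ℂ × ℂ) η, evalAt S.A w z ≠ 0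
  lipschitz : ∀ w ∈ V, LipschitzOnWith K (S.rhs w) (Metric.closedBall ((0, c) : ℂ × ℂ) η)

lemma Box.mono {S : Sys} {c : ℂ} {V : Set ℂ} {η η' : ℝ} {K : ℝ≥0} (h : Box S c V η K)
    (h0 : 0 < η') (h1 : η' ≤ η) : Box S c V η' K :=
  ⟨h.isOpen, h0, fun w hw z hz => h.ne_zero w hw z (Metric.closedBall_subset_closedBall h1 hz),
    fun w hw => (h.lipschitz w hw).mono (Metric.closedBall_subset_closedBall h1)⟩

lemma exists_box (S : Sys) {c : ℂ} {C : Set ℂ} (hC : IsCompact C)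
    (h : ∀ w ∈ C, evalAt S.A w (0, c) ≠ 0) :
    ∃ V η K, C ⊆ V ∧ Box S c V η K := by
  refine hC.induction_on (p := fun s => ∃ V η K, s ⊆ V ∧ Box S c V η K) ?_ ?_ ?_ ?_
  · exact ⟨∅, 1, 0, subset_rfl, isOpen_empty, one_pos, by simp, by simp⟩
  · rintro s t hst ⟨V, η, K, h1, h2⟩
    exact ⟨V, η, K, hst.trans h1, h2⟩
  · rintro s t ⟨V, η, K, h1, h2⟩ ⟨V', η', K', h1', h2'⟩
    have a := h2.mono (lt_min h2.pos h2'.pos) (min_le_left _ _)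
    have b := h2'.mono (lt_min h2.pos h2'.pos) (min_le_right _ _)
    refine ⟨V ∪ V', min η η', max K K', union_subset_union h1 h1', h2.isOpen.union h2'.isOpen,
      a.pos, ?_, ?_⟩
    · rintro w (hw | hw)
      exacts [a.ne_zero w hw, b.ne_zero w hw]
    · rintro w (hw | hw)
      exacts [(a.lipschitz w hw).weaken (le_max_left _ _),
        (b.lipschitz w hw).weaken (le_max_right _ _)]
  · intro w hw
    obtain ⟨K, r, hr, hr'⟩ := exists_lipschitz_rhs S (h w hw)
    exact ⟨Metric.ball w r, mem_nhdsWithin_of_mem_nhds (Metric.ball_mem_nhds _ hr), Metric.ball w r,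
      r, K, subset_rfl, Metric.isOpen_ball, hr, fun v hv => (hr' v hv).2, fun v hv => (hr' v hv).1⟩

/-- The segment from `w0` to `w` lies in `V`. -/
def SegIn (V : Set ℂ) (w0 w : ℂ) : Prop := ∀ s ∈ Icc (0 : ℝ) 1, w0 + s * (w - w0) ∈ V

lemma SegIn.symm {V : Set ℂ} {w0 w : ℂ} (h : SegIn V w0 w) : SegIn V w w0 := by
  intro s hs
  convert h (1 - s) ⟨by linarith [hs.2], by linarith [hs.1]⟩ using 1
  push_cast
  ring

lemma SegIn.left {V : Set ℂ} {w0 w : ℂ} (h : SegIn V w0 w) : w0 ∈ V := by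
  simpa using h 0 (by simp)

lemma SegIn.right {V : Set ℂ} {w0 w : ℂ} (h : SegIn V w0 w) : w ∈ V := by
  simpa using h 1 (by simp)

lemma SegIn.sub {V : Set ℂ} {w0 w : ℂ} (h : SegIn V w0 w) {s : ℝ} (hs : s ∈ Icc (0 : ℝ) 1) :
    SegIn V w0 (w0 + s * (w - w0)) := by
  intro t ht
  convert h (t * s) ⟨mul_nonneg ht.1 hs.1, mul_le_one₀ ht.2 hs.1 hs.2⟩ using 1
  push_cast
  ring

lemma eventually_segIn {V : Set ℂ} (hV : IsOpen V) {w0 w : ℂ} (h : SegIn V w0 w) :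
    ∀ᶠ p in 𝓝 (w0, w), SegIn V p.1 p.2 := by
  refine isCompact_Icc.eventually_forall_of_forall_eventually fun s hs => ?_
  have : Continuous fun p : (ℂ × ℂ) × ℝ => p.1.1 + p.2 * (p.1.2 - p.1.1) := by fun_prop
  exact this.continuousAt.eventually (hV.mem_nhds (h s hs))

/-! ### The flow along segments -/

section Flow

variable {S : Sys} {c : ℂ} {V : Set ℂ} {η : ℝ} {K : ℝ≥0} {w0 w : ℂ}

lemma IsRay.mono {η' : ℝ} {Z : ℝ → ℂ × ℂ} (h : IsRay S c η w0 w Z) (hη : η ≤ η') :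
    IsRay S c η' w0 w Z :=
  ⟨h.hasDerivAt, fun s hs => Metric.closedBall_subset_closedBall hη (h.mem_closedBall s hs)⟩

lemma IsRay.sub {Z : ℝ → ℂ × ℂ} (h : IsRay S c η w0 w Z) {s : ℝ} (hs : s ∈ Icc (0 : ℝ) 1) :
    IsRay S c η w0 (w0 + s * (w - w0)) (fun t => Z (s * t)) := by
  have hst : ∀ t ∈ Icc (0 : ℝ) 1, s * t ∈ Icc (0 : ℝ) 1 := fun t ht =>
    ⟨mul_nonneg hs.1 ht.1, mul_le_one₀ hs.2 ht.1 ht.2⟩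
  refine ⟨fun t ht => ?_, fun t ht => h.mem_closedBall _ (hst t ht)⟩
  have h1 := (h.hasDerivAt _ (hst t ht)).scomp t ((hasDerivAt_id t).const_mul s)
  refine h1.congr_deriv ?_
  rw [mul_one, ← Complex.coe_smul, smul_smul]
  congr 2
  · ring
  · push_cast
    ring

lemma IsRay.symm {Z : ℝ → ℂ × ℂ} (h : IsRay S c η w0 w Z) :
    IsRay S c η w w0 (fun t => Z (1 - t)) := by
  have hst : ∀ t ∈ Icc (0 : ℝ) 1, 1 - t ∈ Icc (0 : ℝ) 1 := fun t ht =>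
    ⟨by linarith [ht.2], by linarith [ht.1]⟩
  refine ⟨fun t ht => ?_, fun t ht => h.mem_closedBall _ (hst t ht)⟩
  have h1 := (h.hasDerivAt _ (hst t ht)).scomp t ((hasDerivAt_id t).const_sub 1)
  refine h1.congr_deriv ?_
  rw [neg_one_smul, ← neg_smul]
  congr 2
  · ring
  · push_cast
    ring

lemma IsRay.eqOn (hB : Box S c V η K) (hV : SegIn V w0 w) {Z Z' : ℝ → ℂ × ℂ}
    (h : IsRay S c η w0 w Z) (h' : IsRay S c η w0 w Z') (h0 : Z 0 = Z' 0) :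
    EqOn Z Z' (Icc 0 1) := by
  refine ODE_solution_unique_of_mem_Icc_right
    (v := fun s z => (w - w0) • S.rhs (w0 + s * (w - w0)) z) (K := ‖w - w0‖₊ * K)
    (s := fun _ => Metric.closedBall ((0, c) : ℂ × ℂ) η) ?_
    (fun s hs => (h.hasDerivAt s hs).continuousAt.continuousWithinAt)
    (fun s hs => (h.hasDerivAt s (Ico_subset_Icc_self hs)).hasDerivWithinAt)
    (fun s hs => h.mem_closedBall s (Ico_subset_Icc_self hs))
    (fun s hs => (h'.hasDerivAt s hs).continuousAt.continuousWithinAt)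
    (fun s hs => (h'.hasDerivAt s (Ico_subset_Icc_self hs)).hasDerivWithinAt)
    (fun s hs => h'.mem_closedBall s (Ico_subset_Icc_self hs)) h0
  intro s hs
  exact (lipschitzWith_smul (w - w0)).comp_lipschitzOnWith
    (hB.lipschitz _ (hV s (Ico_subset_Icc_self hs)))

open Classical in
/-- The value at `w` of the solution of the system along the segment from `w0` to `w` with the
value `z` at `w0`. -/
noncomputable def flow (S : Sys) (c : ℂ) (η : ℝ) (w0 w : ℂ) (z : ℂ × ℂ) : ℂ × ℂ :=
  if h : ∃ Z, IsRay S c η w0 w Z ∧ Z 0 = z then h.choose 1 else 0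

/-- Uniqueness of rays in a box makes the arbitrary choice in `flow` harmless; with a ray at hand
the default value `0` is excluded too. -/
lemma IsRay.flow_eq (hB : Box S c V η K) (hV : SegIn V w0 w) {Z : ℝ → ℂ × ℂ}
    (h : IsRay S c η w0 w Z) {z : ℂ × ℂ} (hz : Z 0 = z) : flow S c η w0 w z = Z 1 := by
  have hex : ∃ Z, IsRay S c η w0 w Z ∧ Z 0 = z := ⟨Z, h, hz⟩
  rw [flow, dif_pos hex]
  exact hex.choose_spec.1.eqOn hB hV h (hex.choose_spec.2.trans hz.symm) (by simp)

lemma flow_self (hB : Box S c V η K) (hw : w ∈ V) {z : ℂ × ℂ}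
    (hz : z ∈ Metric.closedBall ((0, c) : ℂ × ℂ) η) : flow S c η w w z = z := by
  have h : IsRay S c η w w (fun _ => z) :=
    ⟨fun s _ => (hasDerivAt_const s z).congr_deriv (by simp), fun _ _ => hz⟩
  exact h.flow_eq hB (fun s _ => by simpa using hw) rfl

lemma flow_center (hB : Box S c V η K) (hV : SegIn V w0 w) :
    flow S c η w0 w (0, c) = (0, c) := by
  have h : IsRay S c η w0 w (fun _ => (0, c)) :=
    ⟨fun s _ => (hasDerivAt_const s _).congr_deriv (by ext <;> simp [Sys.rhs]),
      fun _ _ => Metric.mem_closedBall_self hB.pos.le⟩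
  exact h.flow_eq hB hV rfl

lemma IsRay.flow_symm (hB : Box S c V η K) (hV : SegIn V w0 w) {Z : ℝ → ℂ × ℂ}
    (h : IsRay S c η w0 w Z) {z : ℂ × ℂ} (hz : Z 0 = z) :
    flow S c η w w0 (flow S c η w0 w z) = z := by
  rw [h.flow_eq hB hV hz, h.symm.flow_eq hB hV.symm (z := Z 1) (by simp)]
  simpa using hz

/-- A ray yields the derivative only in the real direction of the segment. Since complex
differentiability is already known, this one direction determines the derivative, after cancelling
`w - w0 ≠ 0`. -/
lemma IsRay.hasDerivAt_flow (hB : Box S c V η K) (hV : SegIn V w0 w) {Z : ℝ → ℂ × ℂ}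
    (h : IsRay S c η w0 w Z) {z : ℂ × ℂ} (hz : Z 0 = z) (hw : w0 ≠ w) {s : ℝ}
    (hs : s ∈ Icc (0 : ℝ) 1)
    (hd : DifferentiableAt ℂ (fun v => flow S c η w0 v z) (w0 + s * (w - w0))) :
    HasDerivAt (fun v => flow S c η w0 v z)
      (S.rhs (w0 + s * (w - w0)) (flow S c η w0 (w0 + s * (w - w0)) z)) (w0 + s * (w - w0)) := by
  have h1 : ∀ t ∈ Icc (0 : ℝ) 1, flow S c η w0 (w0 + t * (w - w0)) z = Z t := fun t ht => by
    rw [(h.sub ht).flow_eq hB (hV.sub ht) (by simpa using hz), mul_one]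
  have h2 : HasDerivAt (fun t : ℝ => w0 + t * (w - w0)) (w - w0) s := by
    simpa using ((Complex.ofRealCLM.hasDerivAt (x := s)).mul_const (w - w0)).const_add w0
  have h3 := (hd.hasDerivAt.scomp s h2).hasDerivWithinAt (s := Icc 0 1)
  have h4 := (h.hasDerivAt s hs).hasDerivWithinAt (s := Icc 0 1)
  have h5 := (uniqueDiffOn_Icc zero_lt_one s hs).eq_deriv _
    (h3.congr (fun t ht => (h1 t ht).symm) (h1 s hs).symm) h4
  rw [h1 s hs]
  have h6 := smul_right_injective (ℂ × ℂ) (sub_ne_zero.2 hw.symm) h5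
  exact h6 ▸ hd.hasDerivAt

/-- The flow is defined near `q = ((w0, w), z)`, it stays in the closed ball of radius `r` around
`(0, c)`, and it is holomorphic there. -/
structure GoodFlow (S : Sys) (c : ℂ) (η : ℝ) (V : Set ℂ) (r : ℝ) (q : (ℂ × ℂ) × (ℂ × ℂ)) :
    Prop where
  segIn : SegIn V q.1.1 q.1.2
  exists_ray : ∃ Z, IsRay S c (min r η) q.1.1 q.1.2 Z ∧ Z 0 = q.2
  analyticAt : AnalyticAt ℂ (fun q : (ℂ × ℂ) × (ℂ × ℂ) => flow S c η q.1.1 q.1.2 q.2) q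
  hasDerivAt : HasDerivAt (fun v => flow S c η q.1.1 v q.2)
    (S.rhs q.1.2 (flow S c η q.1.1 q.1.2 q.2)) q.1.2

theorem eventually_goodFlow (hB : Box S c V η K) (hV : SegIn V w0 w) {r : ℝ} (hr : 0 < r) :
    ∀ᶠ q in 𝓝 (((w0, w), (0, c)) : (ℂ × ℂ) × (ℂ × ℂ)), GoodFlow S c η V r q := by
  obtain ⟨Φ, hΦ, hΦ'⟩ := exists_local_flow S c w0 w
    (fun s hs => hB.ne_zero _ (hV s hs) _ (Metric.mem_closedBall_self hB.pos.le))
    (lt_min hr hB.pos)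
  have h1 : ∀ᶠ q in 𝓝 (((w0, w), (0, c)) : (ℂ × ℂ) × (ℂ × ℂ)), SegIn V q.1.1 q.1.2 :=
    continuousAt_fst.eventually (eventually_segIn hB.isOpen hV)
  have h2 : Φ =ᶠ[𝓝 (((w0, w), (0, c)) : (ℂ × ℂ) × (ℂ × ℂ))]
      fun q => flow S c η q.1.1 q.1.2 q.2 := by
    filter_upwards [h1, hΦ'] with q hq ⟨Z, hZ, hZ0, hZ1⟩
    rw [(hZ.mono (min_le_right _ _)).flow_eq hB hq hZ0, hZ1]
  have h3 : ∀ᶠ q in 𝓝 (((w0, w), (0, c)) : (ℂ × ℂ) × (ℂ × ℂ)), SegIn V q.1.1 q.1.2 ∧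
      (∃ Z, IsRay S c (min r η) q.1.1 q.1.2 Z ∧ Z 0 = q.2) ∧
      AnalyticAt ℂ (fun q : (ℂ × ℂ) × (ℂ × ℂ) => flow S c η q.1.1 q.1.2 q.2) q := by
    filter_upwards [h1, hΦ', (hΦ.congr h2).eventually_analyticAt] with q hq ⟨Z, hZ, hZ0, _⟩ ha
    exact ⟨hq, ⟨Z, hZ, hZ0⟩, ha⟩
  have hdiff : ∀ q : (ℂ × ℂ) × (ℂ × ℂ),
      AnalyticAt ℂ (fun q : (ℂ × ℂ) × (ℂ × ℂ) => flow S c η q.1.1 q.1.2 q.2) q →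
      DifferentiableAt ℂ (fun v => flow S c η q.1.1 v q.2) q.1.2 := fun q hq =>
    DifferentiableAt.fun_comp' (f := fun v : ℂ => ((q.1.1, v), q.2)) q.1.2
      (g := fun q : (ℂ × ℂ) × (ℂ × ℂ) => flow S c η q.1.1 q.1.2 q.2)
      hq.differentiableAt (by fun_prop)
  filter_upwards [h3.eventually_nhds] with q hq
  obtain ⟨hseg, ⟨Z, hZ, hZ0⟩, ha⟩ := hq.self_of_nhds
  refine ⟨hseg, ⟨Z, hZ, hZ0⟩, ha, ?_⟩
  by_cases hw : q.1.1 = q.1.2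
  -- A degenerate segment has no direction to differentiate along, so a nearby `v` different from
  -- the initial point is chosen and the ray to `v` is differentiated at its start.
  · have hc : ContinuousAt (fun v : ℂ => (((q.1.1, v), q.2) : (ℂ × ℂ) × (ℂ × ℂ))) q.1.2 := by
      fun_prop
    obtain ⟨v, ⟨hv, ⟨Z', hZ', hZ0'⟩, -⟩, hne⟩ := (((hc.eventually hq).filter_mono
      nhdsWithin_le_nhds).and (self_mem_nhdsWithin (s := {q.1.2}ᶜ))).exists
    have := (hZ'.mono (min_le_right _ _)).hasDerivAt_flow hB hv hZ0' (s := 0)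
      (fun h => hne (h.symm.trans hw)) (by simp) (by simpa [hw] using hdiff q ha)
    simpa [hw] using this
  · have := (hZ.mono (min_le_right _ _)).hasDerivAt_flow hB hseg hZ0 (s := 1)
      hw (by simp) (by simpa using hdiff q ha)
    simpa using this

lemma GoodFlow.flow_mem {r : ℝ} {q : (ℂ × ℂ) × (ℂ × ℂ)} (hB : Box S c V η K)
    (h : GoodFlow S c η V r q) :
    flow S c η q.1.1 q.1.2 q.2 ∈ Metric.closedBall ((0, c) : ℂ × ℂ) (min r η) := by
  obtain ⟨Z, hZ, hZ0⟩ := h.exists_ray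
  rw [(hZ.mono (min_le_right _ _)).flow_eq hB h.segIn hZ0]
  exact hZ.mem_closedBall 1 (by simp)

lemma GoodFlow.flow_symm {r : ℝ} {q : (ℂ × ℂ) × (ℂ × ℂ)} (hB : Box S c V η K)
    (h : GoodFlow S c η V r q) :
    flow S c η q.1.2 q.1.1 (flow S c η q.1.1 q.1.2 q.2) = q.2 := by
  obtain ⟨Z, hZ, hZ0⟩ := h.exists_ray
  exact (hZ.mono (min_le_right _ _)).flow_symm hB h.segIn hZ0

end Flow

/-! ### Local uniqueness and independence of the starting point -/

/-- Local uniqueness of holomorphic solutions of ordinary differential equations. -/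
lemma eventuallyEq_of_hasDerivAt {f : ℂ → ℂ × ℂ → ℂ × ℂ} {w0 : ℂ} {g1 g2 : ℂ → ℂ × ℂ} {K : ℝ≥0}
    {U : Set (ℂ × ℂ)} (hU : U ∈ 𝓝 (g1 w0))
    (hf : ∀ᶠ w in 𝓝 w0, LipschitzOnWith K (f w) U)
    (h1 : ∀ᶠ w in 𝓝 w0, HasDerivAt g1 (f w (g1 w)) w)
    (h2 : ∀ᶠ w in 𝓝 w0, HasDerivAt g2 (f w (g2 w)) w) (h0 : g1 w0 = g2 w0) :
    g1 =ᶠ[𝓝 w0] g2 := by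
  have hU1 := h1.self_of_nhds.continuousAt.eventually hU
  have hU2 := h2.self_of_nhds.continuousAt.eventually (h0 ▸ hU)
  obtain ⟨δ, hδ, hball⟩ := Metric.eventually_nhds_iff_ball.1
    (hf.and (h1.and (h2.and (hU1.and hU2))))
  filter_upwards [Metric.ball_mem_nhds w0 hδ] with w hw
  have hseg : ∀ s ∈ Icc (0 : ℝ) 1, w0 + s * (w - w0) ∈ Metric.ball w0 δ := by
    intro s hs
    rw [Metric.mem_ball, dist_eq_norm] at hw ⊢
    rw [add_sub_cancel_left, norm_mul, Complex.norm_real, Real.norm_of_nonneg hs.1]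
    exact (mul_le_of_le_one_left (norm_nonneg _) hs.2).trans_lt hw
  have hd : ∀ (g : ℂ → ℂ × ℂ) (s : ℝ), HasDerivAt g (f (w0 + s * (w - w0))
      (g (w0 + s * (w - w0)))) (w0 + s * (w - w0)) →
      HasDerivAt (fun s : ℝ => g (w0 + s * (w - w0)))
        ((w - w0) • f (w0 + s * (w - w0)) (g (w0 + s * (w - w0)))) s := by
    intro g s hg
    refine hg.scomp s ?_
    simpa using ((Complex.ofRealCLM.hasDerivAt (x := s)).mul_const (w - w0)).const_add w0
  have := ODE_solution_unique_of_mem_Icc_right (a := 0) (b := 1)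
    (v := fun s z => (w - w0) • f (w0 + s * (w - w0)) z) (K := ‖w - w0‖₊ * K) (s := fun _ => U)
    (f := fun s : ℝ => g1 (w0 + s * (w - w0))) (g := fun s : ℝ => g2 (w0 + s * (w - w0)))
    (fun s hs => (lipschitzWith_smul (w - w0)).comp_lipschitzOnWith
      (hball _ (hseg s (Ico_subset_Icc_self hs))).1)
    (fun s hs => (hd g1 s (hball _ (hseg s hs)).2.1).continuousAt.continuousWithinAt)
    (fun s hs => (hd g1 s
      (hball _ (hseg s (Ico_subset_Icc_self hs))).2.1).hasDerivWithinAt)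
    (fun s hs => (hball _ (hseg s (Ico_subset_Icc_self hs))).2.2.2.1)
    (fun s hs => (hd g2 s (hball _ (hseg s hs)).2.2.1).continuousAt.continuousWithinAt)
    (fun s hs => (hd g2 s
      (hball _ (hseg s (Ico_subset_Icc_self hs))).2.2.1).hasDerivWithinAt)
    (fun s hs => (hball _ (hseg s (Ico_subset_Icc_self hs))).2.2.2.2)
    (by simpa using h0) (show (1 : ℝ) ∈ Icc (0 : ℝ) 1 by simp)
  simpa using this

section Consistency

variable {S : Sys} {c : ℂ} {V : Set ℂ} {η : ℝ} {K : ℝ≥0}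

/-- Continuation of a solution to a point does not depend on the point where it starts. -/
lemma eventually_flow_eq (hB : Box S c V η K) {x0 ξ0 : ℂ} {z0 : ℂ × ℂ} {r : ℝ}
    (hgood : ∀ s ∈ Icc (0 : ℝ) 1, ∀ᶠ ζ in 𝓝 (x0 + s * (ξ0 - x0)),
      GoodFlow S c η V r ((x0, ζ), z0))
    {g : ℂ → ℂ × ℂ} (hg : ∀ᶠ x in 𝓝 x0, HasDerivAt g (S.rhs x (g x)) x) (hg0 : g x0 = z0) :
    ∀ᶠ p in 𝓝 (x0, ξ0), flow S c η p.1 p.2 (g p.1) = flow S c η x0 p.2 z0 := by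
  set W := {ζ | GoodFlow S c η V r ((x0, ζ), z0)} with hW
  have hseg : SegIn (interior W) x0 ξ0 := fun s hs => mem_interior_iff_mem_nhds.2 (hgood s hs)
  have hx0 : ∀ᶠ ζ in 𝓝 x0, GoodFlow S c η V r ((x0, ζ), z0) := by simpa using hgood 0 (by simp)
  have hmem : z0 ∈ Metric.closedBall ((0, c) : ℂ × ℂ) η := by
    obtain ⟨Z, hZ, hZ0⟩ := hx0.self_of_nhds.exists_ray
    have := (hZ.mono (min_le_right _ _)).mem_closedBall 0 (by simp)
    rwa [hZ0] at this
  have hfl : flow S c η x0 x0 z0 = z0 := flow_self hB hx0.self_of_nhds.segIn.left hmem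
  obtain ⟨K', r', hr', hK'⟩ := exists_lipschitz_rhs S
    (hB.ne_zero x0 hx0.self_of_nhds.segIn.left z0 hmem)
  have heq : g =ᶠ[𝓝 x0] fun ζ => flow S c η x0 ζ z0 := by
    refine eventuallyEq_of_hasDerivAt (f := S.rhs) (K := K')
      (by rw [hg0]; exact Metric.closedBall_mem_nhds z0 hr') ?_ hg
      (hx0.mono fun ζ hζ => hζ.hasDerivAt) (by rw [hg0, hfl])
    filter_upwards [Metric.ball_mem_nhds x0 hr'] with w hw using (hK' w hw).1
  filter_upwards [eventually_segIn isOpen_interior hseg, continuousAt_fst.eventually heq]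
    with p hp1 hp2
  have hgd : ∀ s ∈ Icc (0 : ℝ) 1, GoodFlow S c η V r ((x0, p.1 + s * (p.2 - p.1)), z0) :=
    fun s hs => (interior_subset : interior W ⊆ W) (hp1 s hs)
  -- The holomorphic function `flow S c η x0 · z0`, read along the displaced segment from `p.1` to
  -- `p.2`, is itself a ray; it starts at `g p.1` because `g` agrees with that function near `x0`.
  have hray : IsRay S c η p.1 p.2 (fun s => flow S c η x0 (p.1 + s * (p.2 - p.1)) z0) := by
    refine ⟨fun s hs => ?_, fun s hs => Metric.closedBall_subset_closedBall (min_le_right _ _)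
      ((hgd s hs).flow_mem hB)⟩
    have hd : HasDerivAt (fun v => flow S c η x0 v z0) _ (p.1 + s * (p.2 - p.1)) :=
      (hgd s hs).hasDerivAt
    refine HasDerivAt.scomp (h := fun s : ℝ => p.1 + s * (p.2 - p.1)) s hd ?_
    simpa using ((Complex.ofRealCLM.hasDerivAt (x := s)).mul_const (p.2 - p.1)).const_add p.1
  have h3 := hray.flow_eq hB (fun s hs => (hgd s hs).segIn.right) (z := g p.1) (by simp [hp2])
  simpa using h3

end Consistency

/-! ### The foliation as a system; lifts and holonomy germs -/

/-- The Painlevé VI foliation in the form `dm/dx = m n₁ / A`, `dt/dx = m n₂ / A`. -/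
noncomputable def baseSys (p : Params) : Sys :=
  open MvPolynomial in
  { n1 := ((X 0 - 1) * (X 0 - X 2) + X 0 * (X 0 - X 2) + X 0 * (X 0 - 1)) +
      (C p.k0 * ((X 0 - 1) + (X 0 - X 2)) + C p.k1 * (X 0 + (X 0 - X 2)) +
        C (p.kt + 1) * (X 0 + (X 0 - 1))) * X 1 + C p.k * X 1 ^ 2
    n2 := X 2 * (X 2 - 1)
    A := C 2 * (X 0 * (X 0 - 1) * (X 0 - X 2)) +
      (C p.k0 * ((X 0 - 1) * (X 0 - X 2)) + C p.k1 * (X 0 * (X 0 - X 2)) +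
        C (p.kt + 1) * (X 0 * (X 0 - 1))) * X 1 }

lemma evalAt_baseSys_A (p : Params) (x : ℂ) (z : ℂ × ℂ) :
    evalAt (baseSys p).A x z = fieldX p x z.1 z.2 := by
  simp [evalAt, baseSys, fieldX, E, F]

lemma baseSys_rhs (p : Params) (x : ℂ) (z : ℂ × ℂ) :
    (baseSys p).rhs x z = (fieldM p x z.1 z.2 / fieldX p x z.1 z.2,
      fieldT z.1 z.2 / fieldX p x z.1 z.2) := by
  rw [Sys.rhs, evalAt_baseSys_A]
  simp [evalAt, baseSys, fieldM, fieldT, Ex, Fx, div_eq_mul_inv]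
  constructor <;> ring

lemma isLocalSolution_iff {p : Params} {g : ℂ → ℂ × ℂ} {x0 : ℂ} :
    IsLocalSolution p (fun x => (g x).1) (fun x => (g x).2) x0 ↔
      ∀ᶠ x in 𝓝 x0, (g x).2 ≠ 0 ∧ (g x).2 ≠ 1 ∧ evalAt (baseSys p).A x (g x) ≠ 0 ∧
        HasDerivAt g ((baseSys p).rhs x (g x)) x := by
  refine eventually_congr (Eventually.of_forall fun x => ?_)
  rw [evalAt_baseSys_A, baseSys_rhs]
  have : HasDerivAt g (fieldM p x (g x).1 (g x).2 / fieldX p x (g x).1 (g x).2,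
      fieldT (g x).1 (g x).2 / fieldX p x (g x).1 (g x).2) x ↔
      HasDerivAt (fun x => (g x).1)
        (fieldM p x (g x).1 (g x).2 / fieldX p x (g x).1 (g x).2) x ∧
      HasDerivAt (fun x => (g x).2) (fieldT (g x).1 (g x).2 / fieldX p x (g x).1 (g x).2) x :=
    ⟨fun h => ⟨h.fst, h.snd⟩, fun h => h.1.prodMk h.2⟩
  rw [this]

lemma IsLocalSolution.eventuallyEq {p : Params} {g g' : ℂ → ℂ × ℂ} {x0 : ℂ}
    (h : IsLocalSolution p (fun x => (g x).1) (fun x => (g x).2) x0)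
    (h' : IsLocalSolution p (fun x => (g' x).1) (fun x => (g' x).2) x0) (h0 : g x0 = g' x0) :
    g =ᶠ[𝓝 x0] g' := by
  rw [isLocalSolution_iff] at h h'
  obtain ⟨K, r, hr, hK⟩ := exists_lipschitz_rhs (baseSys p) h.self_of_nhds.2.2.1
  refine eventuallyEq_of_hasDerivAt (f := (baseSys p).rhs) (K := K)
    (Metric.closedBall_mem_nhds (g x0) hr) ?_ (h.mono fun x hx => hx.2.2.2)
      (h'.mono fun x hx => hx.2.2.2) h0
  filter_upwards [Metric.ball_mem_nhds x0 hr] with w hw using (hK w hw).1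

lemma isLift_iff {p : Params} {γ : C(I, ℂ)} {Γ : I → ℂ × ℂ} :
    IsLift p γ Γ ↔ ∀ s : I, ∃ g : ℂ → ℂ × ℂ,
      IsLocalSolution p (fun x => (g x).1) (fun x => (g x).2) (γ s) ∧
        ∀ᶠ u in 𝓝 s, Γ u = g (γ u) :=
  ⟨fun h s => let ⟨φ, ψ, h1, h2⟩ := h s; ⟨fun x => (φ x, ψ x), h1, h2⟩,
    fun h s => let ⟨g, h1, h2⟩ := h s; ⟨fun x => (g x).1, fun x => (g x).2, h1, h2⟩⟩

lemma IsLift.comp {p : Params} {γ : C(I, ℂ)} {Γ : I → ℂ × ℂ} (h : IsLift p γ Γ) (f : C(I, I)) :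
    IsLift p (γ.comp f) (Γ ∘ f) := fun s =>
  let ⟨φ, ψ, h1, h2⟩ := h (f s)
  ⟨φ, ψ, h1, f.continuous.continuousAt.eventually h2⟩

/-- The set where the lifts agree is open by local uniqueness of solutions, closed by continuity,
and contains `0`; the interval is connected. -/
lemma IsLift.eq {p : Params} {γ : C(I, ℂ)} {Γ Γ' : I → ℂ × ℂ} (h : IsLift p γ Γ)
    (h' : IsLift p γ Γ') (h0 : Γ 0 = Γ' 0) : Γ = Γ' := by
  rw [isLift_iff] at h h'
  have hcl : IsClopen {s | Γ s = Γ' s} := by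
    constructor
    · refine isClosed_iff_nhds.2 fun s hs => ?_
      obtain ⟨g, hg, hΓ⟩ := h s
      obtain ⟨g', hg', hΓ'⟩ := h' s
      by_contra hne
      change ¬ Γ s = Γ' s at hne
      rw [hΓ.self_of_nhds, hΓ'.self_of_nhds] at hne
      have hc := (isLocalSolution_iff.1 hg).self_of_nhds.2.2.2.continuousAt.comp
        γ.continuous.continuousAt
      have hc' := (isLocalSolution_iff.1 hg').self_of_nhds.2.2.2.continuousAt.comp
        γ.continuous.continuousAt
      have hev : ∀ᶠ u in 𝓝 s, Γ u ≠ Γ' u := by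
        filter_upwards [(hc.ne_iff_eventually_ne hc').1 hne, hΓ, hΓ'] with u h1 h2 h3
        rw [h2, h3]
        exact h1
      obtain ⟨u, hu, hu'⟩ := hs _ hev
      exact hu hu'
    · refine isOpen_iff_mem_nhds.2 fun s hs => ?_
      obtain ⟨g, hg, hΓ⟩ := h s
      obtain ⟨g', hg', hΓ'⟩ := h' s
      change Γ s = Γ' s at hs
      rw [hΓ.self_of_nhds, hΓ'.self_of_nhds] at hs
      filter_upwards [hΓ, hΓ', γ.continuous.continuousAt.eventually (hg.eventuallyEq hg' hs)]
        with u h1 h2 h3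
      rw [h1, h2, h3]
  have huniv := hcl.eq_univ ⟨0, h0⟩
  exact funext fun s => by
    have : s ∈ {s | Γ s = Γ' s} := huniv ▸ mem_univ s
    exact this

/-- `h` represents the holonomy germ along `γ`, realized by lifts which stay close to `(0, c)`. -/
structure HasHolonomy (p : Params) (c : ℂ) (γ : C(I, ℂ)) (h : ℂ × ℂ → ℂ × ℂ) : Prop where
  analyticAt : AnalyticAt ℂ h (0, c)
  map_center : h (0, c) = (0, c)
  exists_lift : ∀ ε > 0, ∀ᶠ y in 𝓝 ((0, c) : ℂ × ℂ), ∃ Γ : I → ℂ × ℂ, IsLift p γ Γ ∧ Γ 0 = y ∧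
    Γ 1 = h y ∧ ∀ u, Γ u ∈ Metric.closedBall ((0, c) : ℂ × ℂ) ε

lemma HasHolonomy.isHolonomyGerm {p : Params} {c : ℂ} {γ : C(I, ℂ)} {h : ℂ × ℂ → ℂ × ℂ}
    (hh : HasHolonomy p c γ h) : IsHolonomyGerm p c γ h :=
  ⟨hh.analyticAt, hh.map_center, (hh.exists_lift 1 one_pos).mono
    fun _ ⟨Γ, h1, h2, h3, _⟩ => ⟨Γ, h1, h2, h3⟩⟩

lemma IsHolonomyGerm.eventuallyEq {p : Params} {c : ℂ} {γ : C(I, ℂ)} {h h' : ℂ × ℂ → ℂ × ℂ}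
    (hh : IsHolonomyGerm p c γ h) (hh' : IsHolonomyGerm p c γ h') : h =ᶠ[𝓝 (0, c)] h' := by
  filter_upwards [hh.exists_lift, hh'.exists_lift] with y ⟨Γ, h1, h2, h3⟩ ⟨Γ', h1', h2', h3'⟩
  rw [← h3, ← h3', h1.eq h1' (h2.trans h2'.symm)]

lemma IsHolonomyGerm.tendsto {p : Params} {c : ℂ} {γ : C(I, ℂ)} {h : ℂ × ℂ → ℂ × ℂ}
    (hh : IsHolonomyGerm p c γ h) : Tendsto h (𝓝 (0, c)) (𝓝 (0, c)) := by
  have := hh.analyticAt.continuousAt.tendsto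
  rwa [hh.map_center] at this

/-! ### Transport of lifts and holonomy to a nearby path -/

section Transport

variable {p : Params} {c : ℂ} {V : Set ℂ} {η : ℝ} {K : ℝ≥0} {γ γ' : C(I, ℂ)}

lemma eventually_forall_goodFlow {S : Sys} (hB : Box S c V η K)
    (hV : ∀ u, SegIn V (γ u) (γ' u)) {r : ℝ} (hr : 0 < r) :
    ∀ᶠ z in 𝓝 ((0, c) : ℂ × ℂ), ∀ u : I, ∀ s ∈ Icc (0 : ℝ) 1,
      ∀ᶠ q in 𝓝 (((γ u, γ u + s * (γ' u - γ u)), z) : (ℂ × ℂ) × (ℂ × ℂ)),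
        GoodFlow S c η V r q := by
  have hK : IsCompact ((univ : Set I) ×ˢ Icc (0 : ℝ) 1) := isCompact_univ.prod isCompact_Icc
  have := hK.eventually_forall_of_forall_eventually (x₀ := ((0, c) : ℂ × ℂ))
    (P := fun z us => ∀ᶠ q in
      𝓝 (((γ us.1, γ us.1 + us.2 * (γ' us.1 - γ us.1)), z) : (ℂ × ℂ) × (ℂ × ℂ)),
        GoodFlow S c η V r q) (by
      rintro ⟨u, s⟩ ⟨-, hs⟩
      have hc : Continuous fun a : (ℂ × ℂ) × (I × ℝ) =>
          (((γ a.2.1, γ a.2.1 + a.2.2 * (γ' a.2.1 - γ a.2.1)), a.1) : (ℂ × ℂ) × (ℂ × ℂ)) := by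
        fun_prop
      exact (hc.continuousAt (x := ((0, c), (u, s)))).eventually
        (eventually_goodFlow hB ((hV u).sub hs) hr).eventually_nhds)
  filter_upwards [this] with z hz u s hs using hz (u, s) ⟨mem_univ _, hs⟩

lemma eventually_prodMk_right {a b : ℂ} {z : ℂ × ℂ} {Q : (ℂ × ℂ) × (ℂ × ℂ) → Prop}
    (h : ∀ᶠ q in 𝓝 (((a, b), z) : (ℂ × ℂ) × (ℂ × ℂ)), Q q) : ∀ᶠ ζ in 𝓝 b, Q ((a, ζ), z) := by
  have hc : Continuous fun ζ : ℂ => (((a, ζ), z) : (ℂ × ℂ) × (ℂ × ℂ)) := by fun_prop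
  exact hc.continuousAt.eventually h

/-- A box for the Painlevé VI foliation which lies over `t ≠ 0, 1`. -/
structure BaseBox (p : Params) (c : ℂ) (V : Set ℂ) (η : ℝ) (K : ℝ≥0) : Prop
    extends Box (baseSys p) c V η K where
  base : ∀ z ∈ Metric.closedBall ((0, c) : ℂ × ℂ) η, z.2 ≠ 0 ∧ z.2 ≠ 1

lemma GoodFlow.isLocalSolution {r : ℝ} (hB : BaseBox p c V η K) {a b : ℂ} {z : ℂ × ℂ}
    (h : ∀ᶠ q in 𝓝 (((a, b), z) : (ℂ × ℂ) × (ℂ × ℂ)), GoodFlow (baseSys p) c η V r q) :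
    IsLocalSolution p (fun x => (flow (baseSys p) c η a x z).1)
      (fun x => (flow (baseSys p) c η a x z).2) b := by
  rw [isLocalSolution_iff (g := fun x => flow (baseSys p) c η a x z)]
  filter_upwards [eventually_prodMk_right h] with ζ hζ
  have hm := Metric.closedBall_subset_closedBall (min_le_right r η) (hζ.flow_mem hB.toBox)
  exact ⟨(hB.base _ hm).1, (hB.base _ hm).2, hB.ne_zero _ hζ.segIn.right _ hm, hζ.hasDerivAt⟩

/-- Each point of the lift is continued along the segment from `γ u` to `γ' u`. That the results for
neighbouring `u` lie on a single local solution is the content of `eventually_flow_eq`. -/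
lemma IsLift.transport (hB : BaseBox p c V η K) {r : ℝ} {Γ : I → ℂ × ℂ} (hΓ : IsLift p γ Γ)
    (hgood : ∀ u : I, ∀ s ∈ Icc (0 : ℝ) 1,
      ∀ᶠ q in 𝓝 (((γ u, γ u + s * (γ' u - γ u)), Γ u) : (ℂ × ℂ) × (ℂ × ℂ)),
        GoodFlow (baseSys p) c η V r q) :
    IsLift p γ' (fun u => flow (baseSys p) c η (γ u) (γ' u) (Γ u)) := by
  rw [isLift_iff] at hΓ ⊢
  intro u
  obtain ⟨g, hg, hgΓ⟩ := hΓ u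
  have h1 : ∀ᶠ q in 𝓝 (((γ u, γ' u), Γ u) : (ℂ × ℂ) × (ℂ × ℂ)),
      GoodFlow (baseSys p) c η V r q := by simpa using hgood u 1 (by simp)
  refine ⟨fun x => flow (baseSys p) c η (γ u) x (Γ u), GoodFlow.isLocalSolution hB h1, ?_⟩
  have h2 := eventually_flow_eq hB.toBox
    (fun s hs => eventually_prodMk_right (hgood u s hs))
    ((isLocalSolution_iff.1 hg).mono fun x hx => hx.2.2.2) hgΓ.self_of_nhds.symm
  have hc : Continuous fun v : I => (γ v, γ' v) := by fun_prop
  filter_upwards [hgΓ, hc.continuousAt.eventually h2] with v h3 h4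
  rw [h3]
  exact h4

lemma GoodFlow.analyticAt_flow {S : Sys} {r : ℝ} {a b : ℂ} {z : ℂ × ℂ}
    (h : GoodFlow S c η V r ((a, b), z)) : AnalyticAt ℂ (fun z => flow S c η a b z) z :=
  AnalyticAt.comp (g := fun q : (ℂ × ℂ) × (ℂ × ℂ) => flow S c η q.1.1 q.1.2 q.2)
    (f := fun z : ℂ × ℂ => (((a, b), z) : (ℂ × ℂ) × (ℂ × ℂ))) h.analyticAt
    (analyticAt_const.prod analyticAt_id)

lemma eventually_goodFlow_right {S : Sys} (hB : Box S c V η K) {a b : ℂ} (hV : SegIn V a b) {r : ℝ}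
    (hr : 0 < r) : ∀ᶠ z in 𝓝 ((0, c) : ℂ × ℂ), GoodFlow S c η V r ((a, b), z) := by
  have hc : Continuous fun z : ℂ × ℂ => (((a, b), z) : (ℂ × ℂ) × (ℂ × ℂ)) := by fun_prop
  exact hc.continuousAt.eventually (eventually_goodFlow hB hV hr)

lemma analyticAt_flow_center {S : Sys} (hB : Box S c V η K) {a b : ℂ} (hV : SegIn V a b) :
    AnalyticAt ℂ (fun z => flow S c η a b z) (0, c) :=
  (eventually_goodFlow_right hB hV one_pos).self_of_nhds.analyticAt_flow

lemma tendsto_flow_center {S : Sys} (hB : Box S c V η K) {a b : ℂ} (hV : SegIn V a b) :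
    Tendsto (fun z => flow S c η a b z) (𝓝 (0, c)) (𝓝 (0, c)) := by
  have := (analyticAt_flow_center hB hV).continuousAt.tendsto
  rwa [flow_center hB hV] at this

/-- A lift of `γ'` is obtained by flowing the initial point back to `γ 0`, following `γ`, and
flowing forward again at every parameter. -/
lemma HasHolonomy.transport (hB : BaseBox p c V η K) (hV : ∀ u, SegIn V (γ u) (γ' u))
    {h : ℂ × ℂ → ℂ × ℂ} (hh : HasHolonomy p c γ h) :
    HasHolonomy p c γ' (fun y => flow (baseSys p) c η (γ 1) (γ' 1)
      (h (flow (baseSys p) c η (γ' 0) (γ 0) y))) := by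
  have h0 := flow_center hB.toBox (hV 0).symm
  refine ⟨?_, ?_, fun ε hε => ?_⟩
  · refine AnalyticAt.fun_comp (g := fun z => flow (baseSys p) c η (γ 1) (γ' 1) z) ?_
      (AnalyticAt.fun_comp ?_ (analyticAt_flow_center hB.toBox (hV 0).symm))
    · rw [h0, hh.map_center]
      exact analyticAt_flow_center hB.toBox (hV 1)
    · rw [h0]
      exact hh.analyticAt
  · rw [h0, hh.map_center, flow_center hB.toBox (hV 1)]
  -- The closeness clause of `HasHolonomy` is what makes induction along a homotopy possible: the
  -- old lift must stay in the ball of radius `ε'` where the flow is good, and the new lift then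
  -- stays in the prescribed ball.
  · obtain ⟨ε', hε', hgood⟩ := Metric.nhds_basis_closedBall.eventually_iff.1
      (eventually_forall_goodFlow hB.toBox hV hε)
    filter_upwards [(tendsto_flow_center hB.toBox (hV 0).symm).eventually (hh.exists_lift ε' hε'),
      eventually_goodFlow_right hB.toBox (hV 0).symm one_pos] with y ⟨Γ, h1, h2, h3, h4⟩ h5
    refine ⟨_, h1.transport hB fun u s hs => hgood (h4 u) u s hs, ?_, ?_, fun u => ?_⟩
    · rw [h2]
      exact h5.flow_symm hB.toBox
    · rw [h3]
    · have h6 := (hgood (h4 u) u 1 (by simp)).self_of_nhds.flow_mem hB.toBox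
      exact Metric.closedBall_subset_closedBall (min_le_left _ _) (by simpa using h6)

lemma exists_baseBox (hc0 : c ≠ 0) (hc1 : c ≠ 1)
    (h : ∀ u, SegIn (punctures c)ᶜ (γ u) (γ' u)) :
    ∃ V η K, BaseBox p c V η K ∧ ∀ u, SegIn V (γ u) (γ' u) := by
  have hK : IsCompact ((fun a : I × ℝ => γ a.1 + a.2 * (γ' a.1 - γ a.1)) ''
      ((univ : Set I) ×ˢ Icc (0 : ℝ) 1)) :=
    (isCompact_univ.prod isCompact_Icc).image (by fun_prop)
  obtain ⟨V, η, K, hKV, hB⟩ := exists_box (baseSys p) (c := c) hK (by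
    rintro _ ⟨⟨u, s⟩, ⟨-, hs⟩, rfl⟩
    have := h u s hs
    rw [evalAt_baseSys_A]
    simp only [punctures, mem_compl_iff, mem_insert_iff, mem_singleton_iff, not_or] at this
    simp only [fieldX, E, mul_zero, add_zero]
    exact mul_ne_zero two_ne_zero (mul_ne_zero (mul_ne_zero this.1 (sub_ne_zero.2 this.2.1))
      (sub_ne_zero.2 this.2.2)))
  have hbase : ∀ᶠ z in 𝓝 ((0, c) : ℂ × ℂ), z.2 ≠ 0 ∧ z.2 ≠ 1 :=
    (continuousAt_snd.eventually_ne hc0).and (continuousAt_snd.eventually_ne hc1)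
  obtain ⟨η', hη', hbase⟩ := Metric.nhds_basis_closedBall.eventually_iff.1 hbase
  exact ⟨V, min η η', K, ⟨hB.mono (lt_min hB.pos hη') (min_le_left _ _), fun z hz =>
    hbase (Metric.closedBall_subset_closedBall (min_le_right _ _) hz)⟩,
    fun u s hs => hKV ⟨(u, s), ⟨mem_univ _, hs⟩, rfl⟩⟩

end Transport

/-! ### Homotopy invariance and existence of holonomy -/

lemma isOpen_compl_punctures (c : ℂ) : IsOpen (punctures c)ᶜ :=
  (Set.Finite.isClosed (by simp [punctures])).isOpen_compl

/-- A property of paths which is invariant under straight-line homotopies in the complement of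
the punctures is invariant under homotopies. -/
lemma homotopy_induction {c : ℂ} (H : C(I, C(I, ℂ))) (hH : ∀ s u, H s u ∉ punctures c)
    {Q : C(I, ℂ) → Prop}
    (hQ : ∀ s s', (∀ u, SegIn (punctures c)ᶜ (H s u) (H s' u)) → Q (H s) → Q (H s'))
    (h0 : Q (H 0)) (s : I) : Q (H s) := by
  have hnear : ∀ s, ∀ᶠ s' in 𝓝 s, ∀ u, SegIn (punctures c)ᶜ (H s u) (H s' u) := by
    intro s
    have := isCompact_univ.eventually_forall_of_forall_eventually (K := (univ : Set I)) (x₀ := s)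
      (P := fun s' u => SegIn (punctures c)ᶜ (H s u) (H s' u)) (fun u _ => by
        have hc : Continuous fun a : I × I => (H s a.2, H a.1 a.2) := by fun_prop
        refine hc.continuousAt.eventually (eventually_segIn (isOpen_compl_punctures c) ?_)
        intro t _
        simpa using hH s u)
    filter_upwards [this] with s' hs' u using hs' u (mem_univ u)
  -- Closedness needs only one nearby parameter with the property, because the straight-line
  -- homotopy can be reversed.
  have hcl : IsClopen {s | Q (H s)} := by
    constructor
    · refine isClosed_iff_nhds.2 fun s hs => ?_
      obtain ⟨s', h1, h2⟩ := hs _ (hnear s)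
      exact hQ s' s (fun u => (h1 u).symm) h2
    · refine isOpen_iff_mem_nhds.2 fun s hs => ?_
      filter_upwards [hnear s] with s' h1 using hQ s s' h1 hs
  have huniv := hcl.eq_univ ⟨0, h0⟩
  exact (huniv ▸ mem_univ s : s ∈ {s | Q (H s)})

section Existence

variable {p : Params} {c : ℂ}

lemma hasHolonomy_const (hc0 : c ≠ 0) (hc1 : c ≠ 1) {a : ℂ} (ha : a ∉ punctures c) :
    HasHolonomy p c (ContinuousMap.const I a) id := by
  obtain ⟨V, η, K, hB, hV⟩ := exists_baseBox (p := p) (γ := ContinuousMap.const I a)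
    (γ' := ContinuousMap.const I a) hc0 hc1 (fun u s _ => by simpa using ha)
  have hV' : SegIn V a a := hV 0
  refine ⟨analyticAt_id, rfl, fun ε hε => ?_⟩
  have hc : Continuous fun z : ℂ × ℂ => (((a, a), z) : (ℂ × ℂ) × (ℂ × ℂ)) := by fun_prop
  filter_upwards [hc.continuousAt.eventually
    (eventually_goodFlow hB.toBox hV' hε).eventually_nhds,
    Metric.closedBall_mem_nhds _ (lt_min hε hB.pos)] with y hy hy'
  refine ⟨fun _ => y, isLift_iff.2 fun s => ⟨_, GoodFlow.isLocalSolution hB hy, ?_⟩, rfl, rfl,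
    fun _ => Metric.closedBall_subset_closedBall (min_le_left _ _) hy'⟩
  exact Eventually.of_forall fun u => (flow_self hB.toBox hV'.left
    (Metric.closedBall_subset_closedBall (min_le_right _ _) hy')).symm

/-- The path is contracted to its initial point through `u ↦ γ (s * u)`, which keeps the image
inside that of `γ`; the constant path has the identity as holonomy. -/
theorem exists_hasHolonomy (hc0 : c ≠ 0) (hc1 : c ≠ 1) (γ : C(I, ℂ))
    (hγ : ∀ u, γ u ∉ punctures c) : ∃ h, HasHolonomy p c γ h := by
  let G : C(I × I, ℂ) := ⟨fun a => γ (a.1 * a.2), by fun_prop⟩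
  have h1 := homotopy_induction (c := c) G.curry (fun s u => hγ _)
    (Q := fun γ => ∃ h, HasHolonomy p c γ h) (by
      rintro s s' hss' ⟨h, hh⟩
      obtain ⟨V, η, K, hB, hV⟩ := exists_baseBox (p := p) hc0 hc1 hss'
      exact ⟨_, hh.transport hB hV⟩)
    ⟨id, by
      convert hasHolonomy_const (p := p) hc0 hc1 (hγ 0) using 1
      ext u
      simp [G]⟩ 1
  convert h1
  ext u
  simp [G]

/-- The holonomy along the closed path `γ` is an involution. -/
def IsInvolutive (p : Params) (c : ℂ) (γ : C(I, ℂ)) : Prop :=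
  ∃ h, HasHolonomy p c γ h ∧ h ∘ h =ᶠ[𝓝 (0, c)] id

/-- For closed loops the two flows in `HasHolonomy.transport` run along the same segment in opposite
directions, so they are inverse germs and the holonomy is merely conjugated. -/
lemma IsInvolutive.transport (hc0 : c ≠ 0) (hc1 : c ≠ 1) {γ γ' : C(I, ℂ)}
    (h : ∀ u, SegIn (punctures c)ᶜ (γ u) (γ' u)) (hγ : γ 0 = γ 1) (hγ' : γ' 0 = γ' 1)
    (hi : IsInvolutive p c γ) : IsInvolutive p c γ' := by
  obtain ⟨h, hh, hid⟩ := hi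
  obtain ⟨V, η, K, hB, hV⟩ := exists_baseBox (p := p) hc0 hc1 ‹_›
  refine ⟨_, hh.transport hB hV, ?_⟩
  rw [← hγ, ← hγ']
  have t1 := tendsto_flow_center hB.toBox (hV 0).symm
  have t2 := hh.isHolonomyGerm.tendsto
  filter_upwards [eventually_goodFlow_right hB.toBox (hV 0).symm one_pos, t1.eventually hid,
    (t2.comp t1).eventually (eventually_goodFlow_right hB.toBox (hV 0) one_pos)] with y h1 h2 h3
  simp only [Function.comp_apply, id_eq] at h2 ⊢
  have h4 := h3.flow_symm hB.toBox
  simp only [Function.comp_apply] at h4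
  rw [h4, h2]
  exact h1.flow_symm hB.toBox

lemma IsInvolutive.of_freelyHomotopic (hc0 : c ≠ 0) (hc1 : c ≠ 1) {γ γ' : C(I, ℂ)}
    (h : FreelyHomotopic c γ γ') (hi : IsInvolutive p c γ') : IsInvolutive p c γ := by
  obtain ⟨G⟩ := h.symm
  have hP : ∀ s, G.toHomotopy.curry s 0 = G.toHomotopy.curry s 1 ∧
      ∀ u, G.toHomotopy.curry s u ∉ punctures c := fun s => G.prop s
  have h0 : G.toHomotopy.curry 0 = γ' := by ext u; simp
  have h1 : G.toHomotopy.curry 1 = γ := by ext u; simp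
  rw [← h1]
  exact homotopy_induction G.toHomotopy.curry (fun s => (hP s).2) (Q := IsInvolutive p c)
    (fun s s' hss' => IsInvolutive.transport hc0 hc1 hss' (hP s).1 (hP s').1) (h0.symm ▸ hi) 1

lemma FreelyHomotopic.notMem {γ γ' : C(I, ℂ)} (h : FreelyHomotopic c γ γ') (u : I) :
    γ u ∉ punctures c := by
  obtain ⟨G⟩ := h
  have := (G.prop 0).2 u
  simpa using this

/-! ### Holonomy of concatenated paths -/

/-- The first half of the unit interval. -/
noncomputable def firstHalf : C(I, I) :=
  ⟨fun s => ⟨s / 2, by linarith [s.2.1], by linarith [s.2.2]⟩, by fun_prop⟩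

/-- The second half of the unit interval. -/
noncomputable def secondHalf : C(I, I) :=
  ⟨fun s => ⟨(s + 1) / 2, by linarith [s.2.1], by linarith [s.2.2]⟩, by fun_prop⟩

lemma firstHalf_zero : firstHalf 0 = 0 := by ext; simp [firstHalf]

lemma secondHalf_zero : secondHalf 0 = firstHalf 1 := by ext; simp [firstHalf, secondHalf]

lemma secondHalf_one : secondHalf 1 = 1 := by ext; simp [secondHalf]

/-- The holonomy along a concatenation of paths. -/
lemma IsHolonomyGerm.eventually_end_eq {γ : C(I, ℂ)} {h1 h2 : ℂ × ℂ → ℂ × ℂ}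
    (hh1 : IsHolonomyGerm p c (γ.comp firstHalf) h1)
    (hh2 : IsHolonomyGerm p c (γ.comp secondHalf) h2) :
    ∀ᶠ y in 𝓝 ((0, c) : ℂ × ℂ), ∀ Γ, IsLift p γ Γ → Γ 0 = y → Γ 1 = h2 (h1 y) := by
  filter_upwards [hh1.exists_lift, hh1.tendsto.eventually hh2.exists_lift]
    with y ⟨Γ1, a1, a2, a3⟩ ⟨Γ2, b1, b2, b3⟩ Γ hΓ hΓ0
  have e1 := (hΓ.comp firstHalf).eq a1 (by
    rw [Function.comp_apply, firstHalf_zero, hΓ0, a2])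
  have e2 := (hΓ.comp secondHalf).eq b1 (by
    rw [Function.comp_apply, secondHalf_zero, b2, ← a3, ← e1, Function.comp_apply])
  rw [← b3, ← e2, Function.comp_apply, secondHalf_one]

lemma IsHolonomyGerm.comp {γ : C(I, ℂ)} {h1 h2 : ℂ × ℂ → ℂ × ℂ}
    (hh1 : IsHolonomyGerm p c (γ.comp firstHalf) h1)
    (hh2 : IsHolonomyGerm p c (γ.comp secondHalf) h2) {h : ℂ × ℂ → ℂ × ℂ}
    (hh : IsHolonomyGerm p c γ h) : h =ᶠ[𝓝 (0, c)] h2 ∘ h1 := by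
  filter_upwards [hh.exists_lift, hh1.eventually_end_eq hh2] with y ⟨Γ, a1, a2, a3⟩ hy
  rw [← a3, hy Γ a1 a2, Function.comp_apply]

end Existence

/-! ### Closed lifts from a twofold covering chart -/

/-- The map `(v, z) ↦ (ξ v z, m v z, z.2)` sends a solution of `S` through `(v, z)` to a curve
which is tangent to the Painlevé VI foliation at its image. -/
def MapsTangent (p : Params) (S : Sys) (ξ m : ℂ → ℂ × ℂ → ℂ) (v : ℂ) (z : ℂ × ℂ) : Prop :=
  ∀ g : ℂ → ℂ × ℂ, g v = z → HasDerivAt g (S.rhs v z) v → ∃ s : ℂ,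
    HasDerivAt (fun w => ξ w (g w)) (s * fieldX p (ξ v z) (m v z) z.2) v ∧
    HasDerivAt (fun w => m w (g w)) (s * fieldM p (ξ v z) (m v z) z.2) v ∧
    HasDerivAt (fun w => (g w).2) (s * fieldT (m v z) z.2) v

lemma MapsTangent.exists_hasDerivAt {p : Params} {S : Sys} {ξ m : ℂ → ℂ × ℂ → ℂ} {v : ℂ}
    {g : ℂ → ℂ × ℂ} (h : MapsTangent p S ξ m v (g v)) (hg : HasDerivAt g (S.rhs v (g v)) v)
    (hA : evalAt (baseSys p).A (ξ v (g v)) (m v (g v), (g v).2) ≠ 0) :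
    ∃ l : ℂ, HasDerivAt (fun w => ξ w (g w)) l v ∧
      HasDerivAt (fun w => (m w (g w), (g w).2))
        (l • (baseSys p).rhs (ξ v (g v)) (m v (g v), (g v).2)) v := by
  obtain ⟨s, h1, h2, h3⟩ := h g rfl hg
  rw [evalAt_baseSys_A] at hA
  refine ⟨_, h1, (h2.prodMk h3).congr_deriv ?_⟩
  rw [baseSys_rhs, Prod.smul_mk, smul_eq_mul, smul_eq_mul]
  simp only at hA ⊢
  congr 1 <;> field_simp

/-- A holomorphic curve which is tangent to the foliation and which is close to `D₀(c)` runs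
on the graph of a local solution. -/
lemma eventually_eq_flow {p : Params} {c : ℂ} {V : Set ℂ} {η r : ℝ} {K : ℝ≥0}
    (hB : BaseBox p c V η K) {L : ℂ → ℂ} {G : ℂ → ℂ × ℂ} {v : ℂ}
    (hG : G v ∈ Metric.ball ((0, c) : ℂ × ℂ) η)
    (hgood : ∀ᶠ q in 𝓝 (((L v, L v), G v) : (ℂ × ℂ) × (ℂ × ℂ)),
      GoodFlow (baseSys p) c η V r q)
    (hd : ∀ᶠ w in 𝓝 v, ∃ l : ℂ, HasDerivAt L l w ∧
      HasDerivAt G (l • (baseSys p).rhs (L w) (G w)) w) :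
    ∀ᶠ w in 𝓝 v, G w = flow (baseSys p) c η (L v) (L w) (G v) := by
  have hLV : L v ∈ V := hgood.self_of_nhds.segIn.left
  have hLd : ∀ᶠ w in 𝓝 v, DifferentiableAt ℂ L w :=
    hd.mono fun w ⟨l, hl, _⟩ => hl.differentiableAt
  have hLc : ContinuousAt L v := hLd.self_of_nhds.continuousAt
  have hderiv : ContinuousAt (deriv L) v :=
    (Complex.analyticAt_iff_eventually_differentiableAt.2 hLd).deriv.continuousAt
  have hbound : ∀ᶠ w in 𝓝 v, ‖deriv L w‖ < ‖deriv L v‖ + 1 :=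
    hderiv.norm.eventually (gt_mem_nhds (lt_add_one _))
  have hsol := eventually_prodMk_right hgood
  -- Both sides solve the system pulled back by `L`. No inverse of `L` is used, so zeros of `deriv
  -- L` do no harm.
  refine eventuallyEq_of_hasDerivAt (f := fun w z => deriv L w • (baseSys p).rhs (L w) z)
    (K := ⟨‖deriv L v‖ + 1, by positivity⟩ * K) (U := Metric.closedBall ((0, c) : ℂ × ℂ) η)
    (mem_of_superset (Metric.isOpen_ball.mem_nhds hG) Metric.ball_subset_closedBall) ?_ ?_ ?_ ?_
  · filter_upwards [hbound, hLc.eventually (hB.isOpen.mem_nhds hLV)] with w h1 h2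
    exact ((lipschitzWith_smul (deriv L w)).weaken h1.le).comp_lipschitzOnWith (hB.lipschitz _ h2)
  · filter_upwards [hd] with w ⟨l, h1, h2⟩
    rwa [h1.deriv]
  · filter_upwards [hd, hLc.eventually hsol] with w ⟨l, h1, _⟩ h3
    rw [h1.deriv]
    exact HasDerivAt.scomp (g₁ := fun x => flow (baseSys p) c η (L v) x (G v)) w h3.hasDerivAt h1
  · exact (flow_self hB.toBox hLV (Metric.ball_subset_closedBall hG)).symm

/-- A doubly covering chart: the lifts of the twofold loop `γ` are closed. -/
theorem eventually_exists_closed_lift {p : Params} {c : ℂ} (hc0 : c ≠ 0) (hc1 : c ≠ 1)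
    {γ : C(I, ℂ)} (hγ : ∀ u, γ u ∉ punctures c) (S : Sys) (ξ m : ℂ → ℂ × ℂ → ℂ) {ρ : ℝ}
    (hρ : 0 < ρ) (n : ℤ)
    (hA : ∀ w ∈ Metric.closedBall (0 : ℂ) ρ, evalAt S.A w (0, c) ≠ 0)
    (hξ : ∀ w : ℂ, ‖w‖ = ρ → ContinuousAt (fun a : ℂ × ℂ × ℂ => ξ a.1 a.2) (w, (0, c)))
    (hm : ∀ w : ℂ, ‖w‖ = ρ → ContinuousAt (fun a : ℂ × ℂ × ℂ => m a.1 a.2) (w, (0, c)))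
    (hm0 : ∀ w : ℂ, ‖w‖ = ρ → m w (0, c) = 0)
    (htan : ∀ w : ℂ, ‖w‖ = ρ → ∀ᶠ a in 𝓝 ((w, (0, c)) : ℂ × ℂ × ℂ), MapsTangent p S ξ m a.1 a.2)
    (hloop : ∀ s : I, ξ (ρ * Complex.exp (n * (2 * Real.pi * Complex.I) * ((s : ℝ) : ℂ))) (0, c)
      = γ s)
    (N μ : ℂ × ℂ → ℂ) (hN : ContinuousAt N (0, c)) (hμ : ContinuousAt μ (0, c))
    (hN0 : N (0, c) = (ρ : ℂ) ^ 2) (hμ0 : μ (0, c) = 0)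
    (hsec : ∀ᶠ y in 𝓝 ((0, c) : ℂ × ℂ), ∀ w, w ≠ 0 → w ^ 2 = N y →
      ξ w (μ y / w, y.2) = γ 0 ∧ m w (μ y / w, y.2) = y.1) :
    ∀ᶠ y in 𝓝 ((0, c) : ℂ × ℂ), ∃ Γ : I → ℂ × ℂ, IsLift p γ Γ ∧ Γ 0 = y ∧ Γ 1 = y := by
  -- the section of the chart over the starting point
  set W : ℂ × ℂ → ℂ := fun y => N y ^ (1 / 2 : ℂ) with hW
  have hρ2 : (ρ : ℂ) ^ 2 = ((ρ ^ 2 : ℝ) : ℂ) := by push_cast; rfl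
  have hWsq : ∀ y, W y ^ 2 = N y := fun y => by
    rw [hW]
    simp [← Complex.cpow_nat_mul]
  have hW0 : W (0, c) = ρ := by
    simp only [hW, hN0]
    rw [hρ2, show (1 / 2 : ℂ) = ((1 / 2 : ℝ) : ℂ) by push_cast; rfl,
      ← Complex.ofReal_cpow (by positivity), ← Real.sqrt_eq_rpow, Real.sqrt_sq hρ.le]
  have hWc : ContinuousAt W (0, c) := by
    refine hN.cpow continuousAt_const ?_
    rw [hN0, hρ2]
    exact Complex.ofReal_mem_slitPlane.2 (by positivity)
  have hρ0 : (ρ : ℂ) ≠ 0 := by exact_mod_cast hρ.ne'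
  set z0 : ℂ × ℂ → ℂ × ℂ := fun y => (μ y / W y, y.2) with hz0
  have hz0c : ContinuousAt z0 (0, c) :=
    (hμ.div hWc (by rwa [hW0])).prodMk continuousAt_snd
  have hz00 : z0 (0, c) = (0, c) := by simp [hz0, hμ0]
  -- the loop upstairs
  set e : ℝ → ℂ := fun s => Complex.exp (n * (2 * Real.pi * Complex.I) * (s : ℂ)) with he
  have he_c : Continuous e := by fun_prop
  have he_norm : ∀ s, ‖e s‖ = 1 := fun s => by
    simp only [he]
    rw [show (n * (2 * Real.pi * Complex.I) * (s : ℂ)) =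
      ((n * (2 * Real.pi) * s : ℝ) : ℂ) * Complex.I by push_cast; ring]
    exact Complex.norm_exp_ofReal_mul_I _
  have he0 : e 0 = 1 := by simp [he]
  have he1 : e 1 = 1 := by simp [he, Complex.exp_int_mul_two_pi_mul_I]
  have hnorm : ∀ s, ‖(ρ : ℂ) * e s‖ = ρ := fun s => by
    rw [norm_mul, he_norm, mul_one, Complex.norm_real, Real.norm_of_nonneg hρ.le]
  obtain ⟨V, η, K, hVsub, hB⟩ := exists_box S (isCompact_closedBall (0 : ℂ) ρ) hA
  obtain ⟨V', η', K', hB', hV'⟩ := exists_baseBox (p := p) (γ := γ) (γ' := γ) hc0 hc1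
    (fun u s _ => by simpa using hγ u)
  -- This replaces simple connectedness: the disc is convex, so each point of the circle is reached
  -- by a segment and the flow is a function of the end point alone. Segments may meet `w = 0`,
  -- which is why regularity is required on the whole disc.
  have hseg : ∀ s : ℝ, SegIn V (ρ : ℂ) (ρ * e s) := fun s t ht => by
    refine hVsub ((convex_closedBall (0 : ℂ) ρ).add_smul_sub_mem (x := (ρ : ℂ)) (y := ρ * e s)
      ?_ ?_ ht)
    · simp [abs_of_pos hρ]
    · rw [mem_closedBall_zero_iff, hnorm]
  -- the curve upstairs and its image, depending on the initial point
  set g : ℂ × ℂ → ℂ → ℂ × ℂ := fun y w => flow S c η (W y) w (z0 y) with hg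
  set L : ℂ × ℂ → ℂ → ℂ := fun y w => ξ w (g y w) with hL
  set G : ℂ × ℂ → ℂ → ℂ × ℂ := fun y w => (m w (g y w), (g y w).2) with hG
  have hWf : ∀ s : ℝ, ContinuousAt (fun a : (ℂ × ℂ) × ℝ => W a.1) ((0, c), s) := fun s =>
    ContinuousAt.comp (f := Prod.fst) (g := W) hWc continuousAt_fst
  have hzf : ∀ s : ℝ, ContinuousAt (fun a : (ℂ × ℂ) × ℝ => z0 a.1) ((0, c), s) := fun s =>
    ContinuousAt.comp (f := Prod.fst) (g := z0) hz0c continuousAt_fst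
  have hWs : ∀ s : ℝ, ContinuousAt (fun a : (ℂ × ℂ) × ℝ => W a.1 * e a.2) ((0, c), s) := fun s =>
    (hWf s).mul (he_c.comp continuous_snd).continuousAt
  have hq : ∀ s : ℝ, ContinuousAt (fun a : (ℂ × ℂ) × ℝ =>
      (((W a.1, W a.1 * e a.2), z0 a.1) : (ℂ × ℂ) × (ℂ × ℂ))) ((0, c), s) := fun s =>
    ((hWf s).prodMk (hWs s)).prodMk (hzf s)
  have hgood : ∀ s : ℝ, ∀ᶠ q in
      𝓝 (((W (0, c), W (0, c) * e s), z0 (0, c)) : (ℂ × ℂ) × (ℂ × ℂ)), GoodFlow S c η V 1 q := by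
    intro s
    rw [hW0, hz00]
    exact eventually_goodFlow hB (hseg s) one_pos
  have hgc : ∀ s : ℝ, ContinuousAt (fun a : (ℂ × ℂ) × ℝ => g a.1 (W a.1 * e a.2)) ((0, c), s) :=
    fun s => ContinuousAt.comp
      (g := fun q : (ℂ × ℂ) × (ℂ × ℂ) => flow S c η q.1.1 q.1.2 q.2)
      (f := fun a : (ℂ × ℂ) × ℝ => (((W a.1, W a.1 * e a.2), z0 a.1) : (ℂ × ℂ) × (ℂ × ℂ)))
      (hgood s).self_of_nhds.analyticAt.continuousAt (hq s)
  have hg0 : ∀ s : ℝ, g (0, c) (W (0, c) * e s) = (0, c) := fun s => by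
    simp only [hg]
    rw [hW0, hz00]
    exact flow_center hB (hseg s)
  have hpair : ∀ s : ℝ, ContinuousAt (fun a : (ℂ × ℂ) × ℝ =>
      ((W a.1 * e a.2, g a.1 (W a.1 * e a.2)) : ℂ × ℂ × ℂ)) ((0, c), s) := fun s =>
    (hWs s).prodMk (hgc s)
  have hpair0 : ∀ s : ℝ, ((W (0, c) * e s, g (0, c) (W (0, c) * e s)) : ℂ × ℂ × ℂ) =
      (ρ * e s, (0, c)) := fun s => by rw [hg0, hW0]
  have hLc : ∀ s : ℝ, ContinuousAt (fun a : (ℂ × ℂ) × ℝ => L a.1 (W a.1 * e a.2)) ((0, c), s) :=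
    fun s => ContinuousAt.comp (g := fun a : ℂ × ℂ × ℂ => ξ a.1 a.2)
      (by rw [hpair0]; exact hξ _ (hnorm s)) (hpair s)
  have hL0 : ∀ s : I, L (0, c) (W (0, c) * e s) = γ s := fun s => by
    simp only [hL]
    rw [hg0, hW0]
    exact hloop s
  have hGc : ∀ s : ℝ, ContinuousAt (fun a : (ℂ × ℂ) × ℝ => G a.1 (W a.1 * e a.2)) ((0, c), s) :=
    fun s => ContinuousAt.prodMk (ContinuousAt.comp (g := fun a : ℂ × ℂ × ℂ => m a.1 a.2)
      (by rw [hpair0]; exact hm _ (hnorm s)) (hpair s)) (continuousAt_snd.comp (hgc s))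
  have hG0 : ∀ s : ℝ, G (0, c) (W (0, c) * e s) = (0, c) := fun s => by
    simp only [hG]
    rw [hg0, hW0, hm0 _ (hnorm s)]
  have key1 : ∀ᶠ y in 𝓝 ((0, c) : ℂ × ℂ), ∀ s ∈ Icc (0 : ℝ) 1,
      (∀ᶠ q in 𝓝 (((W y, W y * e s), z0 y) : (ℂ × ℂ) × (ℂ × ℂ)), GoodFlow S c η V 1 q) ∧
      (∀ᶠ a in 𝓝 ((W y * e s, g y (W y * e s)) : ℂ × ℂ × ℂ), MapsTangent p S ξ m a.1 a.2) ∧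
      G y (W y * e s) ∈ Metric.ball ((0, c) : ℂ × ℂ) η' := by
    refine isCompact_Icc.eventually_forall_of_forall_eventually fun s hs => ?_
    have h1 := (htan _ (hnorm s)).eventually_nhds
    rw [← hpair0] at h1
    have h2 : ∀ᶠ z in 𝓝 (G (0, c) (W (0, c) * e s)), z ∈ Metric.ball ((0, c) : ℂ × ℂ) η' := by
      rw [hG0]
      exact Metric.ball_mem_nhds _ hB'.pos
    filter_upwards [(hq s).eventually (hgood s).eventually_nhds, (hpair s).eventually h1,
      (hGc s).eventually h2] with a a1 a2 a3 using ⟨a1, a2, a3⟩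
  -- For general `y` the image curve lies over a perturbation of `γ`, not over `γ`. This provides
  -- the flow along the short segments back to `γ`, uniformly by compactness.
  have key2 : ∀ᶠ y in 𝓝 ((0, c) : ℂ × ℂ), ∀ st ∈ (univ : Set I) ×ˢ Icc (0 : ℝ) 1,
      ∀ᶠ q in 𝓝 (((L y (W y * e st.1), L y (W y * e st.1) +
        st.2 * (γ st.1 - L y (W y * e st.1))), G y (W y * e st.1)) : (ℂ × ℂ) × (ℂ × ℂ)),
        GoodFlow (baseSys p) c η' V' 1 q := by
    refine (isCompact_univ.prod isCompact_Icc).eventually_forall_of_forall_eventually ?_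
    rintro ⟨s, t⟩ ⟨-, ht⟩
    have hproj : ContinuousAt (fun a : (ℂ × ℂ) × (I × ℝ) => (a.1, ((a.2.1 : I) : ℝ)))
      ((0, c), (s, t)) := by fun_prop
    have h1 : ContinuousAt (fun a : (ℂ × ℂ) × (I × ℝ) => L a.1 (W a.1 * e a.2.1))
      ((0, c), (s, t)) := ContinuousAt.comp (f := fun a : (ℂ × ℂ) × (I × ℝ) =>
        (a.1, ((a.2.1 : I) : ℝ))) (g := fun a : (ℂ × ℂ) × ℝ => L a.1 (W a.1 * e a.2))
        (hLc s) hproj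
    have h2 : ContinuousAt (fun a : (ℂ × ℂ) × (I × ℝ) => G a.1 (W a.1 * e a.2.1))
      ((0, c), (s, t)) := ContinuousAt.comp (f := fun a : (ℂ × ℂ) × (I × ℝ) =>
        (a.1, ((a.2.1 : I) : ℝ))) (g := fun a : (ℂ × ℂ) × ℝ => G a.1 (W a.1 * e a.2))
        (hGc s) hproj
    have h3 : ContinuousAt (fun a : (ℂ × ℂ) × (I × ℝ) => (a.2.2 : ℂ)) ((0, c), (s, t)) := by
      fun_prop
    have h4 : ContinuousAt (fun a : (ℂ × ℂ) × (I × ℝ) => γ a.2.1) ((0, c), (s, t)) := by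
      fun_prop
    have h5 : ContinuousAt (fun a : (ℂ × ℂ) × (I × ℝ) => (((L a.1 (W a.1 * e a.2.1),
        L a.1 (W a.1 * e a.2.1) + a.2.2 * (γ a.2.1 - L a.1 (W a.1 * e a.2.1))),
        G a.1 (W a.1 * e a.2.1)) : (ℂ × ℂ) × (ℂ × ℂ))) ((0, c), (s, t)) :=
      (h1.prodMk (h1.add (h3.mul (h4.sub h1)))).prodMk h2
    have h6 : ∀ᶠ a in 𝓝 (((γ s, γ s + t * (γ s - γ s)), (0, c)) : (ℂ × ℂ) × (ℂ × ℂ)),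
        ∀ᶠ q in 𝓝 a, GoodFlow (baseSys p) c η' V' 1 q :=
      (eventually_goodFlow hB'.toBox ((hV' s).sub ht) one_pos).eventually_nhds
    have h7 : (((γ s, γ s + t * (γ s - γ s)), (0, c)) : (ℂ × ℂ) × (ℂ × ℂ)) =
        ((L (0, c) (W (0, c) * e s), L (0, c) (W (0, c) * e s) +
          t * (γ s - L (0, c) (W (0, c) * e s))), G (0, c) (W (0, c) * e s)) := by
      rw [hG0, hL0]
    rw [h7] at h6
    exact h5.eventually h6
  filter_upwards [key1, key2, hsec, hWc.eventually_ne (by rwa [hW0])] with y k1 k2 k3 hWy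
  have hself : g y (W y) = z0 y := by
    obtain ⟨Z, hZ, hZ0⟩ := (k1 0 (by simp)).1.self_of_nhds.exists_ray
    have hmem := (hZ.mono (min_le_right _ _)).mem_closedBall 0 (by simp)
    rw [hZ0] at hmem
    exact flow_self hB (k1 0 (by simp)).1.self_of_nhds.segIn.left hmem
  have hLy : L y (W y) = γ 0 := by
    simp only [hL]
    rw [hself]
    exact (k3 _ hWy (hWsq y)).1
  have hGy : G y (W y) = y := by
    simp only [hG]
    rw [hself]
    exact Prod.ext (k3 _ hWy (hWsq y)).2 rfl
  have k2' : ∀ s : I, ∀ t ∈ Icc (0 : ℝ) 1, ∀ᶠ q in 𝓝 (((L y (W y * e s), L y (W y * e s) +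
        t * (γ s - L y (W y * e s))), G y (W y * e s)) : (ℂ × ℂ) × (ℂ × ℂ)),
        GoodFlow (baseSys p) c η' V' 1 q := fun s t ht => k2 (s, t) ⟨mem_univ _, ht⟩
  have k20 : ∀ s : I, ∀ᶠ q in 𝓝 (((L y (W y * e s), L y (W y * e s)), G y (W y * e s)) :
      (ℂ × ℂ) × (ℂ × ℂ)), GoodFlow (baseSys p) c η' V' 1 q := fun s => by
    simpa using k2' s 0 (by simp)
  have hd : ∀ s : I, ∀ᶠ w in 𝓝 (W y * e s), ∃ l : ℂ, HasDerivAt (L y) l w ∧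
      HasDerivAt (G y) (l • (baseSys p).rhs (L y w) (G y w)) w := by
    intro s
    obtain ⟨a1, a2, a3⟩ := k1 s s.2
    have b1 := eventually_prodMk_right a1
    have hgc' : ContinuousAt (g y) (W y * e s) := b1.self_of_nhds.hasDerivAt.continuousAt
    have b2 : ∀ᶠ w in 𝓝 (W y * e s), MapsTangent p S ξ m w (g y w) :=
      (continuousAt_id.prodMk hgc').eventually a2
    have b3 : evalAt (baseSys p).A (L y (W y * e s)) (G y (W y * e s)) ≠ 0 :=
      hB'.ne_zero _ (k20 s).self_of_nhds.segIn.left _ (Metric.ball_subset_closedBall a3)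
    obtain ⟨l, hl1, hl2⟩ := b2.self_of_nhds.exists_hasDerivAt b1.self_of_nhds.hasDerivAt b3
    have b4 : ∀ᶠ w in 𝓝 (W y * e s), evalAt (baseSys p).A (L y w) (G y w) ≠ 0 :=
      ContinuousAt.eventually_ne (ContinuousAt.comp
        (g := fun x : ℂ × ℂ × ℂ => evalAt (baseSys p).A x.1 x.2)
        (f := fun w => (L y w, G y w)) (analyticAt_evalAt _ _).continuousAt
        (hl1.continuousAt.prodMk hl2.continuousAt)) b3
    filter_upwards [b1, b2, b4] with w c1 c2 c3
    exact c2.exists_hasDerivAt c1.hasDerivAt c3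
  have hec : Continuous fun s : I => W y * e s := by fun_prop
  let γ' : C(I, ℂ) := ⟨fun s => L y (W y * e s), continuous_iff_continuousAt.2 fun s => by
    obtain ⟨l, hl, -⟩ := (hd s).self_of_nhds
    exact ContinuousAt.comp (g := L y) (f := fun s : I => W y * e s) hl.continuousAt
      hec.continuousAt⟩
  have hlift : IsLift p γ' (fun s => G y (W y * e s)) := by
    rw [isLift_iff]
    intro s
    refine ⟨_, GoodFlow.isLocalSolution hB' (k20 s), ?_⟩
    exact hec.continuousAt.eventually
      (eventually_eq_flow hB' (k1 s s.2).2.2 (k20 s) (hd s))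
  -- At both ends the perturbed path already sits at the base point and the curve upstairs is at `W
  -- y`, so the correcting flow is trivial and both ends of the lift equal `y`.
  have hends : ∀ s : I, e s = 1 → γ s = γ 0 → flow (baseSys p) c η' (γ' s) (γ s)
      (G y (W y * e s)) = y := by
    intro s hs hs'
    have h1 : γ' s = γ s := by
      change L y (W y * e s) = γ s
      rw [hs, mul_one, hLy, hs']
    have h2 := (k1 s s.2).2.2
    rw [hs, mul_one, hGy] at h2 ⊢
    rw [h1]
    exact flow_self hB'.toBox (hV' s).left (Metric.ball_subset_closedBall h2)
  have hγ1 : γ 1 = γ 0 := by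
    rw [← hloop 0, ← hloop 1]
    simp [Complex.exp_int_mul_two_pi_mul_I]
  exact ⟨_, hlift.transport hB' (fun s t ht => k2' s t ht), hends 0 (by simpa using he0) rfl,
    hends 1 (by simpa using he1) hγ1⟩

/-! ### From the doubled circle to the involution -/

lemma circleLoop_comp_firstHalf (a : ℂ) (r : ℝ) (n : ℤ) :
    (circleLoop a r (2 * n)).comp firstHalf = circleLoop a r n := by
  ext s
  simp only [circleLoop, firstHalf, ContinuousMap.comp_apply, ContinuousMap.coe_mk]
  push_cast
  ring_nf

lemma circleLoop_comp_secondHalf (a : ℂ) (r : ℝ) (n : ℤ) :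
    (circleLoop a r (2 * n)).comp secondHalf = circleLoop a r n := by
  ext s
  simp only [circleLoop, secondHalf, ContinuousMap.comp_apply, ContinuousMap.coe_mk]
  have : ((2 * n : ℤ) : ℂ) * (2 * Real.pi * Complex.I) * ((((s : ℝ) + 1) / 2 : ℝ) : ℂ) =
      n * (2 * Real.pi * Complex.I) * ((s : ℝ) : ℂ) + n * (2 * Real.pi * Complex.I) := by
    push_cast
    ring
  rw [this, Complex.exp_add, Complex.exp_int_mul_two_pi_mul_I, mul_one]

/-- Both halves of the doubled circle are the circle itself, so the end of a lift of the doubled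
circle is `h (h y)`. -/
lemma isInvolutive_circleLoop {p : Params} {c : ℂ} (hc0 : c ≠ 0) (hc1 : c ≠ 1) {a : ℂ} {r : ℝ}
    {n : ℤ} (h : ∀ u, circleLoop a r n u ∉ punctures c)
    (hcl : ∀ᶠ y in 𝓝 ((0, c) : ℂ × ℂ), ∃ Γ : I → ℂ × ℂ,
      IsLift p (circleLoop a r (2 * n)) Γ ∧ Γ 0 = y ∧ Γ 1 = y) :
    IsInvolutive p c (circleLoop a r n) := by
  obtain ⟨h, hh⟩ := exists_hasHolonomy (p := p) hc0 hc1 _ h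
  have h1 := hh.isHolonomyGerm
  refine ⟨h, hh, ?_⟩
  filter_upwards [hcl, IsHolonomyGerm.eventually_end_eq (γ := circleLoop a r (2 * n))
    (by rwa [circleLoop_comp_firstHalf]) (by rwa [circleLoop_comp_secondHalf])]
    with y ⟨Γ, a1, a2, a3⟩ hy
  rw [Function.comp_apply, ← hy Γ a1 a2, a3, id]

/-! ### Ramified charts at the finite punctures -/

/-- The foliation in the coordinates `(w, y, t)`, where `x - a + α m = w ^ 2`, `m = w y`, near the
fixed puncture `a`; here `b` is the other fixed puncture, and `α`, `β`, `τ` are the coefficients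
of `F` which belong to `a`, `b`, `t`. -/
noncomputable def fixedSys (a b α β τ k : ℂ) : Sys :=
  open MvPolynomial in
  let x := C a + X 0 ^ 2 - C α * (X 0 * X 1)
  let q := (x - C b) * (x - X 2)
  let q' := 2 * x - C b - X 2
  let G := C β * (x - X 2) + C τ * (x - C b)
  let G' := C (β + τ)
  { n1 := X 0 * q' + (G + (x - C a) * G') * X 1 + C k * (X 0 * X 1 ^ 2) -
      C (1 / 2) * (X 1 * (G + C α * q')) -
      C (α / 2) * (X 1 ^ 2 * ((X 0 - C α * X 1) * G' + C k * X 1))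
    n2 := X 2 * (X 2 - 1)
    A := q + C (1 / 2) * (X 0 * X 1 * (G + C α * q')) +
      C (α / 2) * (X 1 ^ 2 * ((x - C a) * G' + C k * (X 0 * X 1))) }

/-- With `q = (x - b) * (x - t)`, the terms `2 (x - a) q + α q m` of `fieldX` and `α q m` of `α *
fieldM` add up to `2 q (x - a + α m) = 2 q w ^ 2`. All other terms contain `(x - a) m` or `m ^ 2`,
so `fieldX + α * fieldM = 2 w ^ 2 A`, and the time change `(w A)⁻¹` normalizes `dw` to `1`. -/
lemma mapsTangent_fixedSys_aux {p : Params} {a b α β : ℂ}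
    (hX : ∀ x m t, fieldX p x m t = 2 * ((x - a) * (x - b) * (x - t)) +
      (α * ((x - b) * (x - t)) + (x - a) * (β * (x - t) + (p.kt + 1) * (x - b))) * m)
    (hM : ∀ x m t, fieldM p x m t = ((x - b) * (x - t) + (x - a) * (2 * x - b - t) +
      (α * (2 * x - b - t) + (β * (x - t) + (p.kt + 1) * (x - b)) +
        (x - a) * (β + (p.kt + 1))) * m + p.k * m ^ 2) * m)
    {v : ℂ} {z : ℂ × ℂ} (hv : v ≠ 0)
    (hA : evalAt (fixedSys a b α β (p.kt + 1) p.k).A v z ≠ 0) :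
    MapsTangent p (fixedSys a b α β (p.kt + 1) p.k) (fun w z => a + w ^ 2 - α * (w * z.1))
      (fun w z => w * z.1) v z := by
  intro g hgv hg
  have h1 : HasDerivAt (fun w => (g w).1) _ v := hg.fst
  have h2 : HasDerivAt (fun w => (g w).2) _ v := hg.snd
  have h3 := (hasDerivAt_id v).mul h1
  have h4 := ((hasDerivAt_pow 2 v).const_add a).sub (h3.const_mul α)
  refine ⟨(v * evalAt (fixedSys a b α β (p.kt + 1) p.k).A v z)⁻¹, h4.congr_deriv ?_,
    h3.congr_deriv ?_, h2.congr_deriv ?_⟩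
  · rw [hX, hgv]
    simp only [Sys.rhs, id_eq]
    field_simp
    simp [evalAt, fixedSys]
    ring
  · rw [hM, hgv]
    simp only [Sys.rhs, id_eq]
    field_simp
    simp [evalAt, fixedSys]
    left
    ring
  · simp only [Sys.rhs, fieldT]
    field_simp
    simp [evalAt, fixedSys]
    ring

lemma mapsTangent_zero {p : Params} {v : ℂ} {z : ℂ × ℂ} (hv : v ≠ 0)
    (hA : evalAt (fixedSys 0 1 p.k0 p.k1 (p.kt + 1) p.k).A v z ≠ 0) :
    MapsTangent p (fixedSys 0 1 p.k0 p.k1 (p.kt + 1) p.k)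
      (fun w z => 0 + w ^ 2 - p.k0 * (w * z.1)) (fun w z => w * z.1) v z :=
  mapsTangent_fixedSys_aux (fun x m t => by simp only [fieldX, E, F]; ring)
    (fun x m t => by simp only [fieldM, Ex, Fx]; ring) hv hA

lemma mapsTangent_one {p : Params} {v : ℂ} {z : ℂ × ℂ} (hv : v ≠ 0)
    (hA : evalAt (fixedSys 1 0 p.k1 p.k0 (p.kt + 1) p.k).A v z ≠ 0) :
    MapsTangent p (fixedSys 1 0 p.k1 p.k0 (p.kt + 1) p.k)
      (fun w z => 1 + w ^ 2 - p.k1 * (w * z.1)) (fun w z => w * z.1) v z :=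
  mapsTangent_fixedSys_aux (fun x m t => by simp only [fieldX, E, F]; ring)
    (fun x m t => by simp only [fieldM, Ex, Fx]; ring) hv hA

lemma evalAt_fixedSys_A (a b α β τ k w c : ℂ) :
    evalAt (fixedSys a b α β τ k).A w (0, c) = (w ^ 2 + a - b) * (w ^ 2 + a - c) := by
  simp [evalAt, fixedSys]
  ring

/-- The foliation in the coordinates `(w, y, t)`, where `x - t + κ_t m = w ^ 2`, `m = w y`, near
the moving puncture `t`. -/
noncomputable def movingSys (p : Params) : Sys :=
  open MvPolynomial in
  let x := X 2 + X 0 ^ 2 - C p.kt * (X 0 * X 1)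
  let G := C p.k0 * (x - 1) + C p.k1 * x
  let G' := C (p.k0 + p.k1)
  let D := G + x + X 2 - 1 + C p.kt * (2 * x - 1)
  { n1 := (X 0 - C p.kt * X 1) * (2 * x - 1) +
      (C (p.kt + 1) * (2 * x - 1) + G + (x - X 2) * G') * X 1 + C p.k * (X 0 * X 1 ^ 2) -
      C (1 / 2) * (X 1 * D) -
      C (p.kt / 2) * (X 1 ^ 2 * ((X 0 - C p.kt * X 1) * (1 + G') + C p.k * X 1))
    n2 := X 2 * (X 2 - 1)
    A := x * (x - 1) + C (1 / 2) * (X 0 * X 1 * D) +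
      C (p.kt / 2) * (X 1 ^ 2 * ((x - X 2) * (1 + G') + C p.k * (X 0 * X 1))) }

/-- The coefficient is `κ_t`, not `κ_t + 1`, because the puncture moves: subtracting `fieldT` turns
the extra `x (x - 1) m` into `(x (x - 1) - t (t - 1)) m`, which is divisible by `(x - t) m`. -/
lemma mapsTangent_moving {p : Params} {v : ℂ} {z : ℂ × ℂ} (hv : v ≠ 0)
    (hA : evalAt (movingSys p).A v z ≠ 0) :
    MapsTangent p (movingSys p) (fun w z => z.2 + w ^ 2 - p.kt * (w * z.1))
      (fun w z => w * z.1) v z := by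
  intro g hgv hg
  have h1 : HasDerivAt (fun w => (g w).1) _ v := hg.fst
  have h2 : HasDerivAt (fun w => (g w).2) _ v := hg.snd
  have h3 := (hasDerivAt_id v).mul h1
  have h4 := (h2.add (hasDerivAt_pow 2 v)).sub (h3.const_mul p.kt)
  refine ⟨(v * evalAt (movingSys p).A v z)⁻¹, h4.congr_deriv ?_,
    h3.congr_deriv ?_, h2.congr_deriv ?_⟩
  · rw [hgv]
    simp only [Sys.rhs, id_eq, fieldX, E, F]
    field_simp
    simp [evalAt, movingSys]
    ring
  · rw [hgv]
    simp only [Sys.rhs, id_eq, fieldM, Ex, Fx]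
    field_simp
    simp [evalAt, movingSys]
    left
    ring
  · simp only [Sys.rhs, fieldT]
    field_simp
    simp [evalAt, movingSys]
    ring

lemma evalAt_movingSys_A (p : Params) (w c : ℂ) :
    evalAt (movingSys p).A w (0, c) = (w ^ 2 + c) * (w ^ 2 + c - 1) := by
  simp [evalAt, movingSys]
  ring

/-! ### Ramified chart at infinity -/

/-- The coefficient `2 ρ + κ₀ + κ₁ + κ_t + 1` of the ramified coordinate at infinity. -/
def Params.kinf (p : Params) (ρ : ℂ) : ℂ := 2 * ρ + p.k0 + p.k1 + p.kt + 1

/-- The foliation near `x = ∞` in the coordinates `(w, y, t)`, where `x = 1 / z`,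
`m = w y / (z (z + ρ w y))` and `z + κ w y = w ^ 2` with `κ = p.kinf ρ`. -/
noncomputable def inftySys (p : Params) (ρ : ℂ) : Sys :=
  open MvPolynomial in
  let κ := p.kinf ρ
  let z1 := X 0 - C κ * X 1
  let z := X 0 * z1
  let u1 := X 0 + C (ρ - κ) * X 1
  let e1 := X 2 * z - 1 - X 2
  let D := C (2 * ρ + p.k0) * e1 - C p.k1 * X 2 - C (p.kt + 1)
  { n1 := z1 * e1 + X 0 * X 2 * u1 ^ 2 + C (1 / 2) * (X 1 * D) +
      C p.k0 * (X 0 * X 1 * X 2 * u1) -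
      C (κ / 2) * (X 2 * X 1 * u1 * (u1 + C p.k0 * X 1))
    n2 := - (X 2 * (X 2 - 1))
    A := (1 - z) * (1 - X 2 * z) + C (1 / 2) * (X 0 * X 1 * D) +
      C (κ / 2) * (X 0 * X 1 * X 2 * u1 * (u1 + C p.k0 * X 1)) }

lemma fieldX_infty (p : Params) {Z U n t : ℂ} (hZ : Z ≠ 0) (hU : U ≠ 0) :
    fieldX p Z⁻¹ (n * (Z * U)⁻¹) t = (2 * ((1 - Z) * (1 - t * Z)) * U +
      (p.k0 * ((1 - Z) * (1 - t * Z)) + p.k1 * (1 - t * Z) + (p.kt + 1) * (1 - Z)) * n) /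
        (Z ^ 3 * U) := by
  simp only [fieldX, E, F]
  field_simp

lemma fieldM_infty (p : Params) {Z U n t : ℂ} (hZ : Z ≠ 0) (hU : U ≠ 0) :
    fieldM p Z⁻¹ (n * (Z * U)⁻¹) t = n * (((1 - Z) * (1 - t * Z) + (1 - t * Z) + (1 - Z)) * U ^ 2 +
      (p.k0 * ((1 - Z) + (1 - t * Z)) + p.k1 * (2 - t * Z) + (p.kt + 1) * (2 - Z)) * n * U +
        p.k * n ^ 2) / (Z * U) ^ 3 := by
  simp only [fieldM, Ex, Fx]
  field_simp
  ring

/-- With `n = w y` and `U = z + ρ n`, the bracket in `fieldX_infty` becomes at `z = 0` the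
combination `2 U + (κ₀ + κ₁ + κ_t + 1) n = 2 z + p.kinf ρ * n`, whence the coefficient in the
ramified coordinate. The equation for `ρ` eliminates `p.k` from the second component, so that
`inftySys` does not involve it. -/
lemma mapsTangent_infty {p : Params} {ρ : ℂ}
    (hρ : ρ ^ 2 + (p.k0 + p.k1 + p.kt + 1) * ρ + p.k = 0) {v : ℂ} {z : ℂ × ℂ} (hv : v ≠ 0)
    (hA : evalAt (inftySys p ρ).A v z ≠ 0) (hz : v ^ 2 - p.kinf ρ * (v * z.1) ≠ 0)
    (hu : v ^ 2 - p.kinf ρ * (v * z.1) + ρ * (v * z.1) ≠ 0) :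
    MapsTangent p (inftySys p ρ) (fun w z => (w ^ 2 - p.kinf ρ * (w * z.1))⁻¹)
      (fun w z => w * z.1 * ((w ^ 2 - p.kinf ρ * (w * z.1)) *
        (w ^ 2 - p.kinf ρ * (w * z.1) + ρ * (w * z.1)))⁻¹) v z := by
  intro g hgv hg
  have hk : p.k = -(ρ ^ 2 + (p.k0 + p.k1 + p.kt + 1) * ρ) := by linear_combination hρ
  subst hgv
  have h1 : HasDerivAt (fun w => (g w).1) _ v := hg.fst
  have h2 : HasDerivAt (fun w => (g w).2) _ v := hg.snd
  have h3 := (hasDerivAt_id v).mul h1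
  have h4 := (hasDerivAt_pow 2 v).sub (h3.const_mul (p.kinf ρ))
  have h5 := h4.add (h3.const_mul ρ)
  have h6 := h4.inv hz
  have h7 := h3.mul ((h4.mul h5).inv (mul_ne_zero hz hu))
  refine ⟨-((v ^ 2 - p.kinf ρ * (v * (g v).1)) *
    (v ^ 2 - p.kinf ρ * (v * (g v).1) + ρ * (v * (g v).1))) *
      (v * evalAt (inftySys p ρ).A v (g v))⁻¹, h6.congr_deriv ?_,
    h7.congr_deriv ?_, h2.congr_deriv ?_⟩
  · rw [fieldX_infty p hz hu]
    simp only [Sys.rhs, id_eq, Pi.sub_apply, Pi.mul_apply]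
    set Z := v ^ 2 - p.kinf ρ * (v * (g v).1) with hZ
    set U := Z + ρ * (v * (g v).1) with hU
    clear_value Z U
    field_simp
    rw [hU, hZ]
    simp [evalAt, inftySys, Params.kinf]
    ring
  · rw [fieldM_infty p hz hu]
    simp only [Sys.rhs, id_eq, Pi.sub_apply, Pi.mul_apply, Pi.add_apply, Pi.inv_apply]
    set Z := v ^ 2 - p.kinf ρ * (v * (g v).1) with hZ
    set U := Z + ρ * (v * (g v).1) with hU
    clear_value Z U
    field_simp
    rw [hU, hZ, hk]
    simp [evalAt, inftySys, Params.kinf]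
    ring
  · simp only [Sys.rhs, fieldT]
    set Z := v ^ 2 - p.kinf ρ * (v * (g v).1) with hZ
    set U := Z + ρ * (v * (g v).1) with hU
    clear_value Z U
    field_simp
    simp [evalAt, inftySys]
    ring

lemma evalAt_inftySys_A (p : Params) (ρ w c : ℂ) :
    evalAt (inftySys p ρ).A w (0, c) = (1 - w ^ 2) * (1 - c * w ^ 2) := by
  simp [evalAt, inftySys]
  ring

/-! ### Involutive holonomy around each puncture -/

lemma norm_sq_le_of_mem_closedBall {w : ℂ} {r : ℝ} (hr : 0 ≤ r)
    (hw : w ∈ Metric.closedBall (0 : ℂ) (√r)) : ‖w ^ 2‖ ≤ r := by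
  rw [mem_closedBall_zero_iff] at hw
  rw [norm_pow, ← Real.sq_sqrt hr]
  gcongr

lemma sq_add_sub_ne_zero {w a b : ℂ} {r : ℝ} (hw : ‖w ^ 2‖ ≤ r) (hb : r < dist b a) :
    w ^ 2 + a - b ≠ 0 := by
  intro h
  rw [dist_eq_norm, show b - a = w ^ 2 by linear_combination -h] at hb
  exact absurd hw (not_le.2 hb)

lemma circleLoop_two_mul_notMem {s : Set ℂ} {a : ℂ} {r : ℝ} {n : ℤ}
    (h : ∀ u, circleLoop a r n u ∉ s) (u : I) : circleLoop a r (2 * n) u ∉ s := by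
  by_cases hu : (u : ℝ) ≤ 1 / 2
  · have hu2 : (2 * u : ℝ) ∈ I := ⟨by linarith [u.2.1], by linarith⟩
    have := h ⟨2 * u, hu2⟩
    have hu' : u = firstHalf ⟨2 * u, hu2⟩ := Subtype.ext (by simp [firstHalf])
    rw [← circleLoop_comp_firstHalf, ContinuousMap.comp_apply, ← hu'] at this
    exact this
  · have hu2 : (2 * u - 1 : ℝ) ∈ I := ⟨by linarith, by linarith [u.2.2]⟩
    have := h ⟨2 * u - 1, hu2⟩
    have hu' : u = secondHalf ⟨2 * u - 1, hu2⟩ := Subtype.ext (by simp [secondHalf])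
    rw [← circleLoop_comp_secondHalf, ContinuousMap.comp_apply, ← hu'] at this
    exact this

/-- The holonomy along a circle around a finite puncture `a` is an involution, if there are
coordinates with `x - f t + α m = w ^ 2`, `m = w y` in which the foliation is regular. -/
lemma isInvolutive_circleLoop_finite {p : Params} {c : ℂ} (hc0 : c ≠ 0) (hc1 : c ≠ 1) {S : Sys}
    {f : ℂ → ℂ} {a b b' α : ℂ} (hf : ContinuousAt f c) (hfc : f c = a)
    (hA : ∀ w, evalAt S.A w (0, c) = (w ^ 2 + a - b) * (w ^ 2 + a - b'))
    (htan : ∀ (v : ℂ) (z : ℂ × ℂ), v ≠ 0 → evalAt S.A v z ≠ 0 →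
      MapsTangent p S (fun w z => f z.2 + w ^ 2 - α * (w * z.1)) (fun w z => w * z.1) v z)
    {r : ℝ} (hr : 0 < r) (hb : r < dist b a) (hb' : r < dist b' a) {n : ℤ}
    (h : ∀ u, circleLoop a r n u ∉ punctures c) :
    IsInvolutive p c (circleLoop a r n) := by
  have hA0 : ∀ w ∈ Metric.closedBall (0 : ℂ) (√r), evalAt S.A w (0, c) ≠ 0 := fun w hw => by
    have := norm_sq_le_of_mem_closedBall hr.le hw
    rw [hA]
    exact mul_ne_zero (sq_add_sub_ne_zero this hb) (sq_add_sub_ne_zero this hb')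
  have hsq : ((√r : ℝ) : ℂ) ^ 2 = r := by
    exact_mod_cast congrArg (Complex.ofReal) (Real.sq_sqrt hr.le)
  have hf2 : ∀ w : ℂ, ContinuousAt (fun a : ℂ × ℂ × ℂ => f a.2.2) (w, (0, c)) := fun w =>
    ContinuousAt.comp (g := f) (f := fun a : ℂ × ℂ × ℂ => a.2.2) hf (by fun_prop)
  have hf1 : ContinuousAt (fun y : ℂ × ℂ => f y.2) (0, c) :=
    ContinuousAt.comp (g := f) (f := fun a : ℂ × ℂ => a.2) hf (by fun_prop)
  have h2 := circleLoop_two_mul_notMem h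
  refine isInvolutive_circleLoop hc0 hc1 h (eventually_exists_closed_lift hc0 hc1 h2 S
    (fun w z => f z.2 + w ^ 2 - α * (w * z.1)) (fun w z => w * z.1) (Real.sqrt_pos.2 hr) n hA0
    (fun w _ => ((hf2 w).add (by fun_prop)).sub (by fun_prop)) (fun w _ => by fun_prop)
    (fun w _ => by simp) (fun w hw => ?_) (fun s => ?_)
    -- The value of `w ^ 2` over the starting point `x = a + r`, solved from `x - f t + α m = w ^
    -- 2`.
    (fun y => a + r - f y.2 + α * y.1) (fun y => y.1) ?_ (by fun_prop) ?_ rfl ?_)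
  · have hw0 : w ≠ 0 := norm_pos_iff.1 (hw ▸ Real.sqrt_pos.2 hr)
    filter_upwards [(analyticAt_evalAt S.A (w, (0, c))).continuousAt.eventually_ne
      (hA0 w (by rw [mem_closedBall_zero_iff, hw])), continuousAt_fst.eventually_ne hw0]
      with x h1 h2 using htan _ _ h2 h1
  · simp only [circleLoop, ContinuousMap.coe_mk, hfc, mul_pow, hsq, ← Complex.exp_nat_mul]
    push_cast
    ring_nf
  · exact (continuousAt_const.sub hf1).add (by fun_prop)
  · simp [hfc, hsq]
  · filter_upwards with y w hw hwy
    constructor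
    · rw [hwy]
      simp [circleLoop]
      field_simp
      ring
    · field_simp

lemma isInvolutive_of_turnsOnceAround {p : Params} {c : ℂ} (hc0 : c ≠ 0) (hc1 : c ≠ 1)
    {a : ℂ} (ha : a ∈ punctures c) {γ : C(I, ℂ)} (h : TurnsOnceAround c a γ) :
    IsInvolutive p c γ := by
  obtain ⟨r, hr, hb, hγ⟩ := h
  have key : ∀ n : ℤ, FreelyHomotopic c γ (circleLoop a r n) → IsInvolutive p c γ := by
    intro n hn
    have hav := FreelyHomotopic.notMem (ContinuousMap.HomotopicWith.symm hn)
    refine IsInvolutive.of_freelyHomotopic hc0 hc1 hn ?_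
    rcases ha with rfl | rfl | rfl
    · exact isInvolutive_circleLoop_finite hc0 hc1 (f := fun _ => 0) continuousAt_const rfl
        (fun w => evalAt_fixedSys_A _ _ _ _ _ _ _ _) (fun v z => mapsTangent_zero) hr
        (hb 1 (by simp [punctures]) one_ne_zero) (hb c (by simp [punctures]) hc0) hav
    · exact isInvolutive_circleLoop_finite hc0 hc1 (f := fun _ => 1) continuousAt_const rfl
        (fun w => evalAt_fixedSys_A _ _ _ _ _ _ _ _) (fun v z => mapsTangent_one) hr
        (hb 0 (by simp [punctures]) zero_ne_one) (hb c (by simp [punctures]) hc1) hav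
    · exact isInvolutive_circleLoop_finite hc0 hc1 (f := fun t => t) continuousAt_id rfl
        (b := 0) (b' := 1) (fun w => by rw [evalAt_movingSys_A, sub_zero])
        (fun v z => mapsTangent_moving) hr
        (hb 0 (by simp [punctures]) hc0.symm) (hb 1 (by simp [punctures]) hc1.symm) hav
  exact hγ.elim (key 1) (key (-1))

lemma exists_root_at_infty (p : Params) :
    ∃ ρ : ℂ, ρ ^ 2 + (p.k0 + p.k1 + p.kt + 1) * ρ + p.k = 0 := by
  obtain ⟨d, hd⟩ := IsAlgClosed.exists_pow_nat_eq
    ((p.k0 + p.k1 + p.kt + 1) ^ 2 - 4 * p.k) (n := 2) two_pos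
  exact ⟨(-(p.k0 + p.k1 + p.kt + 1) + d) / 2, by linear_combination hd / 4⟩

lemma isInvolutive_circleLoop_infty {p : Params} {c : ℂ} (hc0 : c ≠ 0) (hc1 : c ≠ 1) {R : ℝ}
    (h1 : 1 < R) (hc : ‖c‖ < R) {n : ℤ} (h : ∀ u, circleLoop 0 R n u ∉ punctures c) :
    IsInvolutive p c (circleLoop 0 R n) := by
  obtain ⟨ρ, hρ⟩ := exists_root_at_infty p
  have hR : 0 < R := one_pos.trans h1
  have hR' : (R : ℂ) ≠ 0 := by exact_mod_cast hR.ne'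
  have hi : 0 < R⁻¹ := inv_pos.2 hR
  have hA0 : ∀ w ∈ Metric.closedBall (0 : ℂ) (√R⁻¹), evalAt (inftySys p ρ).A w (0, c) ≠ 0 := by
    intro w hw
    have hw2 := norm_sq_le_of_mem_closedBall hi.le hw
    rw [evalAt_inftySys_A]
    refine mul_ne_zero (fun h0 => ?_) (fun h0 => ?_)
    · rw [show w ^ 2 = 1 by linear_combination -h0, norm_one] at hw2
      exact absurd (inv_lt_one_of_one_lt₀ h1) (not_lt.2 hw2)
    · have h3 : ‖c * w ^ 2‖ = 1 := by rw [show c * w ^ 2 = 1 by linear_combination -h0, norm_one]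
      rw [norm_mul] at h3
      have h4 : ‖c‖ * ‖w ^ 2‖ ≤ ‖c‖ * R⁻¹ := by gcongr
      have h5 : ‖c‖ * R⁻¹ < 1 := by rwa [← div_eq_mul_inv, div_lt_one hR]
      linarith
  have hsq : ((√R⁻¹ : ℝ) : ℂ) ^ 2 = (R : ℂ)⁻¹ := by
    have := congrArg Complex.ofReal (Real.sq_sqrt hi.le)
    push_cast at this
    exact this
  have hne : ∀ w : ℂ, ‖w‖ = √R⁻¹ → w ≠ 0 := fun w hw =>
    norm_pos_iff.1 (hw ▸ Real.sqrt_pos.2 hi)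
  -- This is `w y` over the starting point `x = R`: the solution `n` of `m = n / (z (z + ρ n))` with
  -- `z = R⁻¹`.
  have hD : ContinuousAt (fun y : ℂ × ℂ => y.1 * (R : ℂ)⁻¹ ^ 2 * (1 - ρ * y.1 * (R : ℂ)⁻¹)⁻¹)
      (0, c) := ContinuousAt.mul (by fun_prop) (ContinuousAt.inv₀ (by fun_prop) (by simp))
  -- The loop upstairs turns `-n` times, because `x = 1 / z` reverses orientation.
  refine isInvolutive_circleLoop hc0 hc1 h (eventually_exists_closed_lift hc0 hc1
    (circleLoop_two_mul_notMem h) (inftySys p ρ)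
    (fun w z => (w ^ 2 - p.kinf ρ * (w * z.1))⁻¹)
    (fun w z => w * z.1 * ((w ^ 2 - p.kinf ρ * (w * z.1)) *
        (w ^ 2 - p.kinf ρ * (w * z.1) + ρ * (w * z.1)))⁻¹) (Real.sqrt_pos.2 hi) (-n) hA0
    (fun w hw => ?_) (fun w hw => ?_)
    (fun w _ => by simp) (fun w hw => ?_) (fun s => ?_)
    (fun y => (R : ℂ)⁻¹ + p.kinf ρ * (y.1 * (R : ℂ)⁻¹ ^ 2 * (1 - ρ * y.1 * (R : ℂ)⁻¹)⁻¹))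
    (fun y => y.1 * (R : ℂ)⁻¹ ^ 2 * (1 - ρ * y.1 * (R : ℂ)⁻¹)⁻¹) ?_ hD ?_ ?_ ?_)
  · exact ContinuousAt.inv₀ (by fun_prop) (by simpa using hne w hw)
  · exact ContinuousAt.mul (by fun_prop) (ContinuousAt.inv₀ (by fun_prop)
      (by simpa using hne w hw))
  · have e1 : ∀ᶠ a in 𝓝 ((w, (0, c)) : ℂ × ℂ × ℂ), a.1 ^ 2 - p.kinf ρ * (a.1 * a.2.1) ≠ 0 :=
      ContinuousAt.eventually_ne (by fun_prop) (by simpa using hne w hw)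
    have e2 : ∀ᶠ a in 𝓝 ((w, (0, c)) : ℂ × ℂ × ℂ),
        a.1 ^ 2 - p.kinf ρ * (a.1 * a.2.1) + ρ * (a.1 * a.2.1) ≠ 0 :=
      ContinuousAt.eventually_ne (by fun_prop) (by simpa using hne w hw)
    filter_upwards [(analyticAt_evalAt (inftySys p ρ).A (w, (0, c))).continuousAt.eventually_ne
      (hA0 w (by rw [mem_closedBall_zero_iff, hw])), continuousAt_fst.eventually_ne (hne w hw),
      e1, e2] with x x1 x2 x3 x4 using mapsTangent_infty hρ x2 x1 x3 x4
  · simp only [circleLoop, ContinuousMap.coe_mk, mul_pow, hsq, ← Complex.exp_nat_mul, mul_zero,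
      sub_zero, mul_inv, inv_inv, ← Complex.exp_neg, zero_add]
    push_cast
    ring_nf
  · exact continuousAt_const.add (continuousAt_const.mul hD)
  · rw [hsq]
    simp
  · simp
  · have e1 : ∀ᶠ y in 𝓝 ((0, c) : ℂ × ℂ), 1 - ρ * y.1 * (R : ℂ)⁻¹ ≠ 0 :=
      ContinuousAt.eventually_ne (by fun_prop) (by simp)
    filter_upwards [e1] with y hy w hw hwy
    simp only [mul_div_cancel₀ _ hw]
    rw [hwy]
    constructor
    · simp [circleLoop]
    · rw [add_sub_cancel_right]
      have e2 : (R : ℂ)⁻¹ + ρ * (y.1 * (R : ℂ)⁻¹ ^ 2 * (1 - ρ * y.1 * (R : ℂ)⁻¹)⁻¹) =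
          (R : ℂ)⁻¹ * (1 - ρ * y.1 * (R : ℂ)⁻¹)⁻¹ := by
        rw [← sub_eq_zero]
        have : ∀ D : ℂ, D ≠ 0 → D = 1 - ρ * y.1 * (R : ℂ)⁻¹ →
            (R : ℂ)⁻¹ + ρ * (y.1 * (R : ℂ)⁻¹ ^ 2 * D⁻¹) - (R : ℂ)⁻¹ * D⁻¹ = 0 := by
          intro D hD0 hD1
          have : (R : ℂ)⁻¹ + ρ * (y.1 * (R : ℂ)⁻¹ ^ 2 * D⁻¹) - (R : ℂ)⁻¹ * D⁻¹ =
              (R : ℂ)⁻¹ * D⁻¹ * (D - (1 - ρ * y.1 * (R : ℂ)⁻¹)) := by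
            field_simp
            ring
          rw [this, ← hD1, sub_self, mul_zero]
        exact this _ hy rfl
      rw [e2]
      generalize 1 - ρ * y.1 * (R : ℂ)⁻¹ = D at hy
      field_simp

lemma isInvolutive_of_turnsOnceAroundInfinity {p : Params} {c : ℂ} (hc0 : c ≠ 0) (hc1 : c ≠ 1)
    {γ : C(I, ℂ)} (h : TurnsOnceAroundInfinity c γ) : IsInvolutive p c γ := by
  obtain ⟨R, hR, hb, hγ⟩ := h
  have key : ∀ n : ℤ, FreelyHomotopic c γ (circleLoop 0 R n) → IsInvolutive p c γ := fun n hn =>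
    IsInvolutive.of_freelyHomotopic hc0 hc1 hn (isInvolutive_circleLoop_infty hc0 hc1
      (by simpa using hb 1 (by simp [punctures])) (hb c (by simp [punctures]))
      (FreelyHomotopic.notMem (ContinuousMap.HomotopicWith.symm hn)))
  exact hγ.elim (key 1) (key (-1))

/-! ### Two-sheeted leaves near `(0, 0, c)` -/

/-- A function whose logarithmic derivative is small on a disc varies little there. -/
lemma norm_sub_le_half_of_hasDerivAt {y q : ℂ → ℂ} {r C : ℝ} (hr : 0 < r) (hC : 0 ≤ C)
    (hrC : 8 * (r * C) ≤ 1)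
    (hy : ∀ w ∈ Metric.closedBall (0 : ℂ) r, HasDerivAt y (y w * q w) w)
    (hq : ∀ w ∈ Metric.closedBall (0 : ℂ) r, ‖q w‖ ≤ C) {w1 w2 : ℂ}
    (h1 : w1 ∈ Metric.closedBall (0 : ℂ) r) (h2 : w2 ∈ Metric.closedBall (0 : ℂ) r) :
    ‖y w1 - y w2‖ ≤ ‖y w1‖ / 2 := by
  obtain ⟨w3, h3, hmax⟩ := (isCompact_closedBall (0 : ℂ) r).exists_isMaxOn
    (Metric.nonempty_closedBall.2 hr.le)
    (f := fun w => ‖y w‖) (fun w hw => (hy w hw).continuousAt.norm.continuousWithinAt)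
  have key : ∀ a ∈ Metric.closedBall (0 : ℂ) r, ∀ b ∈ Metric.closedBall (0 : ℂ) r,
      ‖y b - y a‖ ≤ ‖y w3‖ / 4 := by
    intro a ha b hb
    have h4 := (convex_closedBall (0 : ℂ) r).norm_image_sub_le_of_norm_hasDerivWithin_le
      (f := y) (f' := fun w => y w * q w) (C := ‖y w3‖ * C)
      (fun w hw => (hy w hw).hasDerivWithinAt) (fun w hw => by
        rw [norm_mul]
        exact mul_le_mul (hmax hw) (hq w hw) (norm_nonneg _) (norm_nonneg _)) ha hb
    have h5 : ‖b - a‖ ≤ 2 * r := by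
      rw [mem_closedBall_zero_iff] at ha hb
      linarith [norm_sub_le b a]
    calc _ ≤ ‖y w3‖ * C * ‖b - a‖ := h4
      _ ≤ ‖y w3‖ * C * (2 * r) := by gcongr
      _ = ‖y w3‖ * (8 * (r * C)) / 4 := by ring
      _ ≤ ‖y w3‖ * 1 / 4 := by gcongr
      _ = _ := by ring
  have h6 := key w1 h1 w3 h3
  have h7 := key w2 h2 w1 h1
  -- The maximum is at most `4 / 3` of `‖y w1‖`, so the oscillation is at most a third of `‖y w1‖`.
  have h8 : ‖y w3‖ ≤ ‖y w1‖ + ‖y w3 - y w1‖ := by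
    simpa using norm_add_le (y w1) (y w3 - y w1)
  linarith [norm_nonneg (y w1)]

theorem exists_isTwoSheetedLeaf (p : Params) {c : ℂ} (hc0 : c ≠ 0) (hc1 : c ≠ 1) :
    ∃ r > 0, ∃ δ > 0, ∀ x m t : ℂ, ‖x + p.k0 * m‖ < r ^ 2 → m ≠ 0 →
      ‖m‖ ^ 2 < δ * ‖x + p.k0 * m‖ → ‖t - c‖ < δ →
      ∃ L M T : ℂ → ℂ, IsTwoSheetedLeaf p r L M T ∧
        ∃ w ∈ Metric.ball (0 : ℂ) r, L w = x ∧ M w = m ∧ T w = t := by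
  set S := fixedSys 0 1 p.k0 p.k1 (p.kt + 1) p.k with hS
  -- Half the distance from `0` to the nearest other puncture, so `A` has no zero on the disc `‖w ^
  -- 2‖ ≤ q`.
  set q := min 1 ‖c‖ / 2 with hq
  have hm : 0 < min 1 ‖c‖ := lt_min one_pos (norm_pos_iff.2 hc0)
  have hq0 : 0 < q := half_pos hm
  have hA0 : ∀ w ∈ Metric.closedBall (0 : ℂ) (√q), evalAt S.A w (0, c) ≠ 0 := fun w hw => by
    have h1 := norm_sq_le_of_mem_closedBall hq0.le hw
    have h2 : q < min 1 ‖c‖ := half_lt_self hm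
    rw [hS, evalAt_fixedSys_A]
    exact mul_ne_zero (sq_add_sub_ne_zero h1 (by simpa using h2.trans_le (min_le_left _ _)))
      (sq_add_sub_ne_zero h1 (by simpa using h2.trans_le (min_le_right _ _)))
  obtain ⟨V, η', K, hV, hB'⟩ := exists_box S (isCompact_closedBall (0 : ℂ) (√q)) hA0
  have hbase : ∀ᶠ z in 𝓝 ((0, c) : ℂ × ℂ), z.2 ≠ 0 ∧ z.2 ≠ 1 :=
    (continuousAt_snd.eventually_ne hc0).and (continuousAt_snd.eventually_ne hc1)
  obtain ⟨η'', hη'', hbase⟩ := Metric.nhds_basis_closedBall.eventually_iff.1 hbase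
  set η := min η' η'' with hη
  have hB : Box S c V η K := hB'.mono (lt_min hB'.pos hη'') (min_le_left _ _)
  obtain ⟨C, hC⟩ := ((isCompact_closedBall (0 : ℂ) (√q)).prod
    (isCompact_closedBall ((0, c) : ℂ × ℂ) η)).exists_bound_of_continuousOn
    (f := fun a : ℂ × ℂ × ℂ => evalAt S.n1 a.1 a.2 * (evalAt S.A a.1 a.2)⁻¹) (fun a ha =>
      ((analyticAt_evalAt S.n1 a).mul ((analyticAt_evalAt S.A a).inv
        (hB.ne_zero _ (hV ha.1) _ ha.2))).continuousAt.continuousWithinAt)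
  have hC1 : 0 < |C| + 1 := by positivity
  set r := min (√q) (1 / (8 * (|C| + 1))) with hr
  have hr0 : 0 < r := lt_min (Real.sqrt_pos.2 hq0) (by positivity)
  have hrC : 8 * (r * (|C| + 1)) ≤ 1 := by
    have : r ≤ 1 / (8 * (|C| + 1)) := min_le_right _ _
    rw [le_div_iff₀ (by positivity)] at this
    linarith
  have hrq : Metric.closedBall (0 : ℂ) r ⊆ Metric.closedBall 0 (√q) :=
    Metric.closedBall_subset_closedBall (min_le_left _ _)
  have hgood := ((isCompact_closedBall (0 : ℂ) r).prod
    (isCompact_closedBall (0 : ℂ) r)).eventually_forall_of_forall_eventually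
    (x₀ := ((0, c) : ℂ × ℂ)) (P := fun z ab => ∀ᶠ a in 𝓝 ((ab, z) : (ℂ × ℂ) × (ℂ × ℂ)),
      GoodFlow S c η V 1 a) (by
      rintro ⟨a, b⟩ ⟨ha, hb⟩
      have hseg : SegIn V a b := fun s hs =>
        hV (hrq ((convex_closedBall (0 : ℂ) r).add_smul_sub_mem ha hb hs))
      have hcont : Continuous fun x : (ℂ × ℂ) × (ℂ × ℂ) => (x.2, x.1) := by fun_prop
      exact (hcont.continuousAt (x := ((0, c), (a, b)))).eventually
        (eventually_goodFlow hB hseg one_pos).eventually_nhds)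
  obtain ⟨ε, hε, hgood⟩ := Metric.nhds_basis_closedBall.eventually_iff.1 hgood
  -- The bound `ε ^ 2` controls `‖m / w0‖ ^ 2 = ‖m‖ ^ 2 / ‖x + κ₀ m‖`, and `ε` controls `t - c`.
  refine ⟨r, hr0, min ε (ε ^ 2), lt_min hε (by positivity), ?_⟩
  intro x m t hx hm0 hmx ht
  obtain ⟨w0, hw0⟩ := IsAlgClosed.exists_pow_nat_eq (x + p.k0 * m) (n := 2) two_pos
  have hw0r : ‖w0‖ < r := by
    refine lt_of_pow_lt_pow_left₀ 2 hr0.le ?_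
    rwa [← norm_pow, hw0]
  have hw0_ne : w0 ≠ 0 := by
    rintro rfl
    rw [← hw0] at hmx
    simp only [ne_eq, OfNat.ofNat_ne_zero, not_false_eq_true, zero_pow, norm_zero, mul_zero] at hmx
    exact absurd hmx (not_lt.2 (by positivity))
  have hw0b : w0 ∈ Metric.closedBall (0 : ℂ) r := mem_closedBall_zero_iff.2 hw0r.le
  set z : ℂ × ℂ := (m / w0, t) with hz
  have hzε : z ∈ Metric.closedBall ((0, c) : ℂ × ℂ) ε := by
    rw [Metric.mem_closedBall, Prod.dist_eq]
    refine max_le ?_ ?_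
    · rw [hz, dist_zero_right]
      refine le_of_lt (lt_of_pow_lt_pow_left₀ 2 hε.le ?_)
      rw [← norm_pow, div_pow, hw0, norm_div, norm_pow, div_lt_iff₀
        (by rw [← hw0, norm_pow]; exact pow_pos (norm_pos_iff.2 hw0_ne) 2)]
      exact hmx.trans_le (mul_le_mul_of_nonneg_right (min_le_right _ _) (norm_nonneg _))
    · rw [hz, dist_eq_norm]
      exact ht.le.trans (min_le_left _ _)
  set g : ℂ → ℂ × ℂ := fun w => flow S c η w0 w z with hg
  have hgf : ∀ w ∈ Metric.closedBall (0 : ℂ) r, GoodFlow S c η V 1 ((w0, w), z) := fun w hw =>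
    (hgood hzε (w0, w) ⟨hw0b, hw⟩).self_of_nhds
  have hgd : ∀ w ∈ Metric.closedBall (0 : ℂ) r, HasDerivAt g (S.rhs w (g w)) w := fun w hw =>
    (hgf w hw).hasDerivAt
  have hgm : ∀ w ∈ Metric.closedBall (0 : ℂ) r, g w ∈ Metric.closedBall ((0, c) : ℂ × ℂ) η :=
    fun w hw => Metric.closedBall_subset_closedBall (min_le_right _ _) ((hgf w hw).flow_mem hB)
  have hg0 : g w0 = z := by
    obtain ⟨Z, hZ, hZ0⟩ := (hgf w0 hw0b).exists_ray
    have hmem := (hZ.mono (min_le_right _ _)).mem_closedBall 0 (by simp)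
    rw [hZ0] at hmem
    exact flow_self hB (hgf w0 hw0b).segIn.left hmem
  have hhalf : ∀ w1 ∈ Metric.closedBall (0 : ℂ) r, ∀ w2 ∈ Metric.closedBall (0 : ℂ) r,
      ‖(g w1).1 - (g w2).1‖ ≤ ‖(g w1).1‖ / 2 := fun w1 h1 w2 h2 =>
    norm_sub_le_half_of_hasDerivAt (y := fun w => (g w).1)
      (q := fun w => evalAt S.n1 w (g w) * (evalAt S.A w (g w))⁻¹) hr0 hC1.le hrC
      (fun w hw => (hgd w hw).fst) (fun w hw => (hC (w, g w) ⟨hrq hw, hgm w hw⟩).trans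
        ((le_abs_self C).trans (lt_add_one _).le)) h1 h2
  have hne : ∀ w ∈ Metric.closedBall (0 : ℂ) r, (g w).1 ≠ 0 := by
    intro w hw h0
    have h1 := hhalf w hw w0 hw0b
    rw [h0, hg0] at h1
    simp only [zero_sub, norm_neg, norm_zero, zero_div] at h1
    exact absurd (norm_le_zero_iff.1 h1) (div_ne_zero hm0 hw0_ne)
  have hb : ∀ w ∈ Metric.ball (0 : ℂ) r, w ∈ Metric.closedBall (0 : ℂ) r := fun w hw =>
    Metric.ball_subset_closedBall hw
  have h0b : (0 : ℂ) ∈ Metric.closedBall (0 : ℂ) r := Metric.mem_closedBall_self hr0.le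
  have hMd : ∀ w ∈ Metric.closedBall (0 : ℂ) r, HasDerivAt (fun w => w * (g w).1)
      (1 * (g w).1 + w * (S.rhs w (g w)).1) w := fun w hw => (hasDerivAt_id w).mul (hgd w hw).fst
  refine ⟨fun w => 0 + w ^ 2 - p.k0 * (w * (g w).1), fun w => w * (g w).1, fun w => (g w).2,
    ⟨?_, ?_, ?_, ?_, ?_, ?_, ?_, ?_, ?_, ?_, ?_⟩, w0, mem_ball_zero_iff.2 hw0r, ?_, ?_, ?_⟩
  · intro w hw
    exact (DifferentiableAt.sub (by fun_prop)
      ((hMd w (hb w hw)).differentiableAt.const_mul p.k0)).differentiableWithinAt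
  · exact fun w hw => (hMd w (hb w hw)).differentiableAt.differentiableWithinAt
  · intro w hw
    have h : HasDerivAt (fun w => (g w).2) _ w := (hgd w (hb w hw)).snd
    exact h.differentiableAt.differentiableWithinAt
  · intro w hw w' hw' hww'
    simp only [Prod.mk.injEq] at hww'
    obtain ⟨e1, e2, -⟩ := hww'
    rw [e2] at e1
    have e3 : w ^ 2 = w' ^ 2 := by linear_combination e1
    rcases sq_eq_sq_iff_eq_or_eq_neg.1 e3 with h | h
    · exact h
    · by_cases hw'0 : w' = 0
      · rw [h, hw'0, neg_zero]
      · exfalso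
        -- Equal values of `m` at `w'` and `-w'` would force `y` to change sign, which a relative
        -- variation of at most one half forbids.
        rw [h, neg_mul, ← mul_neg] at e2
        have e4 := mul_left_cancel₀ hw'0 e2
        have e5 := hhalf w' (hb w' hw') w (hb w hw)
        rw [h, ← e4, show -(g (-w')).1 - (g (-w')).1 = -2 * (g (-w')).1 by ring, norm_neg,
          norm_mul, norm_neg] at e5
        have e6 : 0 < ‖(g (-w')).1‖ := norm_pos_iff.2 (hne _ (h ▸ hb w hw))
        norm_num at e5
        linarith
  · intro w _
    ring
  · simp
  · simp
  · rw [(hMd 0 h0b).deriv]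
    simpa using hne 0 h0b
  · exact fun w hw => hbase (Metric.closedBall_subset_closedBall (min_le_right _ _)
      (hgm w (hb w hw)))
  · exact fun w hw hw' => mul_ne_zero hw' (hne w (hb w hw))
  · exact fun w hw hw' => mapsTangent_zero hw' (hB.ne_zero _ (hV (hrq (hb w hw))) _
      (hgm w (hb w hw))) g rfl (hgd w (hb w hw))
  · beta_reduce
    rw [hg0]
    simp only [hz]
    rw [mul_div_cancel₀ _ hw0_ne]
    linear_combination hw0
  · beta_reduce
    rw [hg0]
    simp only [hz]
    rw [mul_div_cancel₀ _ hw0_ne]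
  · beta_reduce
    rw [hg0]

/-! ### Products of loops and conclusion -/

lemma IsInvolutive.comp_self {p : Params} {c : ℂ} {γ : C(I, ℂ)} (hi : IsInvolutive p c γ)
    {h : ℂ × ℂ → ℂ × ℂ} (hh : IsHolonomyGerm p c γ h) : h ∘ h =ᶠ[𝓝 (0, c)] id := by
  obtain ⟨h', hh', hid⟩ := hi
  have heq := hh.eventuallyEq hh'.isHolonomyGerm
  filter_upwards [heq, hh.tendsto.eventually heq, hid] with y h1 h2 h3
  rw [Function.comp_apply, h2, h1]
  exact h3

lemma trans_comp_firstHalf {P : ℂ} (γ γ' : Path P P) :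
    ((γ.trans γ' : Path P P) : C(I, ℂ)).comp firstHalf = (γ : C(I, ℂ)) := by
  ext s
  have hs : (s : ℝ) / 2 ≤ 1 / 2 := by linarith [s.2.2]
  simp only [ContinuousMap.comp_apply, Path.trans_apply, firstHalf,
    ContinuousMap.coe_mk, dif_pos hs]
  congr 1
  exact Subtype.ext (by ring)

lemma trans_comp_secondHalf {P : ℂ} (γ γ' : Path P P) :
    ((γ.trans γ' : Path P P) : C(I, ℂ)).comp secondHalf = (γ' : C(I, ℂ)) := by
  ext s
  by_cases hs : ((s : ℝ) + 1) / 2 ≤ 1 / 2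
  · have hs0 : s = 0 := Subtype.ext (le_antisymm (show (s : ℝ) ≤ 0 by linarith) s.2.1)
    subst hs0
    simp only [ContinuousMap.comp_apply, Path.trans_apply, secondHalf,
      ContinuousMap.coe_mk, dif_pos hs]
    rw [γ'.source]
    convert γ.target
    simp
  · simp only [ContinuousMap.comp_apply, Path.trans_apply, secondHalf,
      ContinuousMap.coe_mk, dif_neg hs]
    congr 1
    exact Subtype.ext (by ring)

lemma TurnsOnceAround.notMem {c a : ℂ} {γ : C(I, ℂ)} (h : TurnsOnceAround c a γ) (u : I) :
    γ u ∉ punctures c := by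
  obtain ⟨r, -, -, h | h⟩ := h
  exacts [h.notMem u, h.notMem u]

/-- The holonomy along a product of two loops. -/
lemma IsHolonomyGerm.trans {p : Params} {c P : ℂ} {γ γ' : Path P P} {h h' : ℂ × ℂ → ℂ × ℂ}
    (hc0 : c ≠ 0) (hc1 : c ≠ 1) (hγ : ∀ u, γ u ∉ punctures c) (hγ' : ∀ u, γ' u ∉ punctures c)
    (hh : IsHolonomyGerm p c γ h) (hh' : IsHolonomyGerm p c γ' h') :
    IsHolonomyGerm p c (γ.trans γ' : Path P P) (h' ∘ h) := by
  have hav : ∀ u, γ.trans γ' u ∉ punctures c := fun u hu => by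
    have h1 : γ.trans γ' u ∈ range (γ.trans γ') := mem_range_self u
    rw [Path.trans_range] at h1
    rcases h1 with ⟨v, hv⟩ | ⟨v, hv⟩
    · exact hγ v (hv ▸ hu)
    · exact hγ' v (hv ▸ hu)
  -- Lifts of the two factors are not glued: the product loop has some holonomy germ, and uniqueness
  -- of lifts on each half identifies it.
  obtain ⟨k, hk⟩ := exists_hasHolonomy (p := p) hc0 hc1 (γ.trans γ' : Path P P) hav
  have heq := IsHolonomyGerm.comp (γ := (γ.trans γ' : Path P P))
    (by rwa [trans_comp_firstHalf]) (by rwa [trans_comp_secondHalf]) hk.isHolonomyGerm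
  refine ⟨hk.analyticAt.congr heq, ?_, ?_⟩
  · rw [Function.comp_apply, hh.map_center, hh'.map_center]
  · filter_upwards [heq, hk.isHolonomyGerm.exists_lift] with y hy ⟨Γ, h1, h2, h3⟩
    exact ⟨Γ, h1, h2, h3.trans hy⟩

end PVI

theorem lemma2 (p : PVI.Params) (c : ℂ) (hc0 : c ≠ 0) (hc1 : c ≠ 1)
    (P : ℂ) (γ0 γ1 γc : Path P P)
    (hγ0 : PVI.TurnsOnceAround c 0 γ0) (hγ1 : PVI.TurnsOnceAround c 1 γ1)
    (hγc : PVI.TurnsOnceAround c c γc) :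
    -- the three holonomy germs exist
    (∃ h0 h1 hc : ℂ × ℂ → ℂ × ℂ, PVI.IsHolonomyGerm p c γ0 h0 ∧
      PVI.IsHolonomyGerm p c γ1 h1 ∧ PVI.IsHolonomyGerm p c γc hc) ∧
    -- the relations; `h0 ∘ h1 ∘ hc` is the holonomy along `γc`, then `γ1`, then `γ0`
    (∀ h0 h1 hc : ℂ × ℂ → ℂ × ℂ, PVI.IsHolonomyGerm p c γ0 h0 →
      PVI.IsHolonomyGerm p c γ1 h1 → PVI.IsHolonomyGerm p c γc hc →
      h0 ∘ h0 =ᶠ[𝓝 (0, c)] id ∧ h1 ∘ h1 =ᶠ[𝓝 (0, c)] id ∧ hc ∘ hc =ᶠ[𝓝 (0, c)] id ∧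
      (PVI.TurnsOnceAroundInfinity c (γc.trans (γ1.trans γ0)) →
        (h0 ∘ h1 ∘ hc) ∘ (h0 ∘ h1 ∘ hc) =ᶠ[𝓝 (0, c)] id)) ∧
    -- near the singular point `(0, 0, c)`, the leaves close to `D₀(c)` are two-sheeted covers
    (∃ r > 0, ∃ δ > 0, ∀ x m t : ℂ, ‖x + p.k0 * m‖ < r ^ 2 → m ≠ 0 →
      ‖m‖ ^ 2 < δ * ‖x + p.k0 * m‖ → ‖t - c‖ < δ →
      ∃ L M T : ℂ → ℂ, PVI.IsTwoSheetedLeaf p r L M T ∧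
        ∃ w ∈ Metric.ball (0 : ℂ) r, L w = x ∧ M w = m ∧ T w = t) := by
  refine ⟨?_, fun h0 h1 hc hh0 hh1 hhc => ⟨?_, ?_, ?_, fun hinf => ?_⟩,
    PVI.exists_isTwoSheetedLeaf p hc0 hc1⟩
  · obtain ⟨h0, hh0⟩ := PVI.exists_hasHolonomy (p := p) hc0 hc1 γ0 hγ0.notMem
    obtain ⟨h1, hh1⟩ := PVI.exists_hasHolonomy (p := p) hc0 hc1 γ1 hγ1.notMem
    obtain ⟨hc, hhc⟩ := PVI.exists_hasHolonomy (p := p) hc0 hc1 γc hγc.notMem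
    exact ⟨h0, h1, hc, hh0.isHolonomyGerm, hh1.isHolonomyGerm, hhc.isHolonomyGerm⟩
  · exact (PVI.isInvolutive_of_turnsOnceAround hc0 hc1 (by simp [PVI.punctures]) hγ0).comp_self hh0
  · exact (PVI.isInvolutive_of_turnsOnceAround hc0 hc1 (by simp [PVI.punctures]) hγ1).comp_self hh1
  · exact (PVI.isInvolutive_of_turnsOnceAround hc0 hc1 (by simp [PVI.punctures]) hγc).comp_self hhc
  · have h10 := PVI.IsHolonomyGerm.trans hc0 hc1 hγ1.notMem hγ0.notMem hh1 hh0
    have hav : ∀ u, γ1.trans γ0 u ∉ PVI.punctures c := fun u hu => by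
      have hu' : γ1.trans γ0 u ∈ Set.range (γ1.trans γ0) := Set.mem_range_self u
      rw [Path.trans_range] at hu'
      rcases hu' with ⟨v, hv⟩ | ⟨v, hv⟩
      · exact hγ1.notMem v (hv.symm ▸ hu)
      · exact hγ0.notMem v (hv.symm ▸ hu)
    have h10c := PVI.IsHolonomyGerm.trans hc0 hc1 hγc.notMem hav hhc h10
    exact (PVI.isInvolutive_of_turnsOnceAroundInfinity hc0 hc1 hinf).comp_self h10c
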